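/- Let $\lambda>0$ and let $f:\mathbb R\to\mathbb R$ satisfy: $f$ is continuous; $f(t)=-f(-t)$ for all $t\in\mathbb R$; $\lim_{t\to0}f(t)/t=0$; $\lim_{t\to+\infty}f(t)/t^3=1$ and $f(t)/t^3<1$ for all $t\ne0$; $t\mapsto f(t)/t^3$ is strictly increasing on $(0,\infty)$; and $\lim_{t\to+\infty}[f(t)t-4F(t)]=+\infty$, where $F(t)=\int_0^tf(\tau)\,d\tau$. Let $H^1_{rad}(\mathbb R^3)$ be the space of radial functions in $H^1(\mathbb R^3)$, with norm $\|u\|=\big(\int_{\mathbb R^3}(|\nabla u|^2+u^2)\,dx\big)^{1/2}$. For $u\in H^1_{rad}(\mathbb R^3)$ put $\phi_u=\frac1{4\pi|\cdot|}*u^2$ and $$I(u)=\frac12\int_{\mathbb R^3}\big(|\nabla u|^2+u^2\big)\,dx+\frac\lambda4\int_{\mathbb R^3}\phi_u u^2\,dx-\int_{\mathbb R^3}F(u)\,dx .$$ Write $u^+=\max\{u,0\}$ and $u^-=\min\{u,0\}$, let $I'$ denote the Fréchet derivative of $I$ on $H^1_{rad}(\mathbb R^3)$, and let $$\mathcal M=\{u\in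 H^1_{rad}(\mathbb R^3)\setminus\{0\}:\ I'(u)[u]=0,\ I'(u)[u^+]=0,\ u^+\not\equiv0,\ u^-\not\equiv0\}.$$ If the infimum $c=\inf_{\mathcal M}I$ is attained at some $u\in\mathcal M$, then $u$ is a critical point of $I$ on $H^1_{rad}(\mathbb R^3)$, i.e. $I'(u)=0$. In particular, $c$ is a critical value of $I$. -/

import Mathlib

open MeasureTheory Filter Topology Set
open scoped ContDiff

/-- Three-dimensional Euclidean space. -/
abbrev E3 : Type := EuclideanSpace ℝ (Fin 3)

/-- `g` is the weak (distributional) gradient of `u` on `ℝ³`: for every test function `ψ` and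
every direction `v` one has `∫ u ∂ᵥψ = - ∫ (g · v) ψ`. -/
def IsWeakGradient (u : E3 → ℝ) (g : E3 → E3) : Prop :=
  ∀ ψ : E3 → ℝ, ContDiff ℝ ∞ ψ → HasCompactSupport ψ → ∀ v : E3,
    ∫ x, u x * fderiv ℝ ψ x v = - ∫ x, inner ℝ (g x) v * ψ x

/-- The Hilbert space `L²(ℝ³) × L²(ℝ³; ℝ³)` with the norm `‖(u, g)‖² = |u|₂² + |g|₂²`. -/
abbrev L2Pair : Type :=
  WithLp 2 (Lp ℝ 2 (volume : Measure E3) × Lp E3 2 (volume : Measure E3))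

theorem integrable_testDeriv (u : Lp ℝ 2 (volume : Measure E3)) {ψ : E3 → ℝ}
    (hψ : ContDiff ℝ ∞ ψ) (hc : HasCompactSupport ψ) (v : E3) :
    Integrable (fun x => u x * fderiv ℝ ψ x v) := by
  have hcont : Continuous (fun x => fderiv ℝ ψ x v) :=
    (hψ.continuous_fderiv (by simp)).clm_apply continuous_const
  have hcs : HasCompactSupport (fun x => fderiv ℝ ψ x v) := hc.fderiv_apply ℝ v
  exact MemLp.integrable_mul (p := 2) (q := 2) (Lp.memLp u) (hcont.memLp_of_hasCompactSupport hcs)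

theorem integrable_testGrad (g : Lp E3 2 (volume : Measure E3)) {ψ : E3 → ℝ}
    (hψ : ContDiff ℝ ∞ ψ) (hc : HasCompactSupport ψ) (v : E3) :
    Integrable (fun x => inner ℝ (g x) v * ψ x) :=
  MemLp.integrable_mul (p := 2) (q := 2) ((Lp.memLp g).inner_const v)
    (hψ.continuous.memLp_of_hasCompactSupport hc)

/-- The Sobolev space `H¹(ℝ³)`, realised as the space of the pairs `(u, ∇u)` with `u ∈ L²(ℝ³)`
and weak gradient `∇u ∈ L²(ℝ³; ℝ³)`.  The norm that it inherits is the usual one,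
`‖u‖ = (|∇u|₂² + |u|₂²)^{1/2}`. -/
def H1 : Submodule ℝ L2Pair where
  carrier := {w | IsWeakGradient w.fst w.snd}
  zero_mem' := by
    intro ψ _ _ v
    have h1 : (fun x => (0 : L2Pair).fst x * fderiv ℝ ψ x v) =ᵐ[volume] fun _ => (0 : ℝ) := by
      filter_upwards with x
      simp
    have h2 : (fun x => inner ℝ ((0 : L2Pair).snd x) v * ψ x) =ᵐ[volume] fun _ => (0 : ℝ) := by
      filter_upwards with x
      simp
    rw [integral_congr_ae h1, integral_congr_ae h2]
    simp
  add_mem' := by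
    intro a b ha hb ψ hψ hc v
    have h1 : (fun x => (a + b).fst x * fderiv ℝ ψ x v) =ᵐ[volume]
        fun x => a.fst x * fderiv ℝ ψ x v + b.fst x * fderiv ℝ ψ x v := by
      filter_upwards [Lp.coeFn_add a.fst b.fst] with x hx
      simp only [WithLp.add_fst, hx, Pi.add_apply, add_mul]
    have h2 : (fun x => inner ℝ ((a + b).snd x) v * ψ x) =ᵐ[volume]
        fun x => inner ℝ (a.snd x) v * ψ x + inner ℝ (b.snd x) v * ψ x := by
      filter_upwards [Lp.coeFn_add a.snd b.snd] with x hx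
      simp only [WithLp.add_snd, hx, Pi.add_apply, inner_add_left, add_mul]
    rw [integral_congr_ae h1, integral_congr_ae h2,
      integral_add (integrable_testDeriv _ hψ hc v) (integrable_testDeriv _ hψ hc v),
      integral_add (integrable_testGrad _ hψ hc v) (integrable_testGrad _ hψ hc v),
      ha ψ hψ hc v, hb ψ hψ hc v, neg_add]
  smul_mem' := by
    intro t a ha ψ hψ hc v
    have h1 : (fun x => (t • a).fst x * fderiv ℝ ψ x v) =ᵐ[volume]
        fun x => t * (a.fst x * fderiv ℝ ψ x v) := by
      filter_upwards [Lp.coeFn_smul t a.fst] with x hx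
      simp only [WithLp.smul_fst, hx, Pi.smul_apply, smul_eq_mul, mul_assoc]
    have h2 : (fun x => inner ℝ ((t • a).snd x) v * ψ x) =ᵐ[volume]
        fun x => t * (inner ℝ (a.snd x) v * ψ x) := by
      filter_upwards [Lp.coeFn_smul t a.snd] with x hx
      simp only [WithLp.smul_snd, hx, Pi.smul_apply, real_inner_smul_left, mul_assoc]
    rw [integral_congr_ae h1, integral_congr_ae h2, integral_const_mul, integral_const_mul,
      ha ψ hψ hc v, mul_neg]

/-- The pairs whose first component is (almost everywhere) a function of `|x|` only. -/
def radialPairs : Submodule ℝ L2Pair where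
  carrier := {w | ∃ h : ℝ → ℝ, ∀ᵐ x : E3, w.fst x = h ‖x‖}
  zero_mem' := by
    refine ⟨fun _ => 0, ?_⟩
    filter_upwards with x
    simp
  add_mem' := by
    rintro a b ⟨h, hh⟩ ⟨k, hk⟩
    refine ⟨fun r => h r + k r, ?_⟩
    filter_upwards [hh, hk, Lp.coeFn_add a.fst b.fst] with x h1 h2 h3
    simp only [WithLp.add_fst, h3, Pi.add_apply, h1, h2]
  smul_mem' := by
    rintro t a ⟨h, hh⟩
    refine ⟨fun r => t * h r, ?_⟩
    filter_upwards [hh, Lp.coeFn_smul t a.fst] with x h1 h2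
    simp only [WithLp.smul_fst, h2, Pi.smul_apply, h1, smul_eq_mul]

/-- The space `H¹_rad(ℝ³)` of radial functions in `H¹(ℝ³)`, with the norm of `H¹(ℝ³)`. -/
abbrev H1rad : Type := ↥(H1 ⊓ radialPairs)

noncomputable section

/-- The function `u : ℝ³ → ℝ` underlying an element of `H¹_rad(ℝ³)`. -/
def H1rad.fn (u : H1rad) : E3 → ℝ := u.1.fst

/-- The weak gradient `∇u : ℝ³ → ℝ³` of an element of `H¹_rad(ℝ³)`. -/
def H1rad.grad (u : H1rad) : E3 → E3 := u.1.snd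

/-- The Poisson potential `φ_u = (1 / (4π|·|)) * u²`, the solution of `-Δφ = u²`. -/
def poissonPotential (u : E3 → ℝ) (x : E3) : ℝ :=
  ∫ y, 1 / (4 * Real.pi * ‖x - y‖) * u y ^ 2

/-- The primitive `F(t) = ∫₀ᵗ f`. -/
def primitiveF (f : ℝ → ℝ) (t : ℝ) : ℝ := ∫ τ in (0 : ℝ)..t, f τ

/-- The energy functional `I` on `H¹_rad(ℝ³)`,
`I(u) = ½ ∫ (|∇u|² + u²) + (lam/4) ∫ φ_u u² - ∫ F(u)`. -/
def energy (f : ℝ → ℝ) (lam : ℝ) (u : H1rad) : ℝ :=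
  1 / 2 * (∫ x, (‖u.grad x‖ ^ 2 + u.fn x ^ 2))
    + lam / 4 * (∫ x, poissonPotential u.fn x * u.fn x ^ 2)
    - ∫ x, primitiveF f (u.fn x)

/-- The Nehari set `N = {u ∈ H¹_rad(ℝ³) \ {0} : I'(u)[u] = 0}`. -/
def nehariSet (f : ℝ → ℝ) (lam : ℝ) : Set H1rad :=
  {u | u ≠ 0 ∧ fderiv ℝ (energy f lam) u u = 0}

/-- `p` is the element `u⁺ = max {u, 0}` of `H¹_rad(ℝ³)`. -/
def IsPosPart (u p : H1rad) : Prop := ∀ᵐ x : E3, p.fn x = max (u.fn x) 0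

/-- `m` is the element `u⁻ = min {u, 0}` of `H¹_rad(ℝ³)`. -/
def IsNegPart (u m : H1rad) : Prop := ∀ᵐ x : E3, m.fn x = min (u.fn x) 0

/-- The nodal Nehari set `M = {u ∈ N : I'(u)[u⁺] = 0, u⁺ ≢ 0, u⁻ ≢ 0}`.  The elements `u⁺`, `u⁻`
of `H¹_rad(ℝ³)` exist for every `u` and are determined by `u`. -/
def nodalNehariSet (f : ℝ → ℝ) (lam : ℝ) : Set H1rad :=
  {u | u ∈ nehariSet f lam ∧ ∃ p m : H1rad, IsPosPart u p ∧ IsNegPart u m ∧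
    fderiv ℝ (energy f lam) u p = 0 ∧ p ≠ 0 ∧ m ≠ 0}

/-- `u` is a critical point of `J` on `H¹_rad(ℝ³)`: `J` is Fréchet differentiable at `u` and
`J'(u) = 0`. -/
def IsCriticalPoint (J : H1rad → ℝ) (u : H1rad) : Prop :=
  HasFDerivAt J (0 : H1rad →L[ℝ] ℝ) u

/-- `c` is a critical value of `J`: the value of `J` at some critical point. -/
def IsCriticalValue (J : H1rad → ℝ) (c : ℝ) : Prop :=
  ∃ u : H1rad, IsCriticalPoint J u ∧ J u = c

end

/-!
The functional `I` is differentiable on `H¹_rad(ℝ³)` and `(w, v) ↦ I'(w)[v]` is continuous. This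
rests on the embedding of `H¹(ℝ³)` into `L⁴`, obtained by mollification from the
Gagliardo–Nirenberg–Sobolev inequality for smooth functions: the Coulomb term is the restriction to
the diagonal of a bounded quadrilinear form (`isQuarticForm_coulombForm`), and the local term is
treated by dominated convergence (`hasFDerivAt_integral_primitiveF`, `continuous_nonlinearity`). The
truncation `u ↦ u⁺` is continuous for the norm of `H¹` (`H1rad.continuous_pos`); the point is the
chain rule for weak gradients, together with `∇u = 0` almost everywhere on `{u = 0}`.

Let `u` be the minimiser, `p = u⁺` and `n = (-u)⁺`, so that `u = p - n`. Since `p` and `n` are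
orthogonal with disjoint supports, only the Coulomb energy couples `s p` and `t n`, through the
nonnegative term `s² t² D(p², n²)`. Together with `I'(u)[p] = I'(u)[n] = 0` and the monotonicity of
`f(t) / t³` this gives two facts about the family `s p - t n` with `s, t > 0`. The energy is
largest at `(1, 1)` (`IsDisjointPair.energy_family_le`). The partial derivative in `s` is positive
where `s < 1` and `s ≤ t`, and negative where `s > 1` and `t ≤ s`; the partial derivative in `t`
behaves symmetrically (`IsDisjointPair.energyDeriv_pos`, `IsDisjointPair.energyDeriv_lt_zero`).

If `I'(u) ≠ 0`, take `v` with `I'(u)[v] < 0`. For a small `e > 0` the functions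
`w = s p - t n + e v` with `(s, t)` in a small square about `(1, 1)` have nonzero positive and
negative parts, and `I'(w)[w⁺]`, `I'(w)[w⁻]` keep the strict signs on the sides of the square. By
the planar Poincaré–Miranda theorem (`poincare_miranda`) both vanish at some `(s, t)`, so that `w`
lies in the nodal Nehari set. But `I(w) < I(s p - t n) ≤ I(u)`, which contradicts minimality. This
is `fderiv_eq_zero_of_nodal_minimizer`. No deformation flow and no uniqueness of the maximum are
needed, only the continuity of `I'`.
-/

-- needed for the normed space structure of `H →L[ℝ] H →L[ℝ] H →L[ℝ] H →L[ℝ] ℝ`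
set_option maxSynthPendingDepth 3

/-! ### Planar Poincaré–Miranda theorem -/

/-- A continuous angle that stays in the upper half plane (`sin > 0`) and passes from the right
half plane to the left one has increased. -/
theorem angle_lt_of_sin_pos {φ : ℝ → ℝ} (hφ : Continuous φ) {x y : ℝ}
    (hs : ∀ z ∈ uIcc x y, 0 < Real.sin (φ z)) (hx : 0 < Real.cos (φ x))
    (hy : Real.cos (φ y) < 0) : φ x < φ y := by
  by_contra! h
  have hsub : Icc (φ y) (φ x) ⊆ φ '' uIcc x y := by
    have := intermediate_value_uIcc (a := x) (b := y) hφ.continuousOn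
    rwa [uIcc_comm (φ x), uIcc_of_le h] at this
  have hanti : AntitoneOn Real.cos (Icc (φ y) (φ x)) := by
    refine antitoneOn_of_deriv_nonpos (convex_Icc _ _) Real.continuous_cos.continuousOn
      Real.differentiable_cos.differentiableOn fun z hz => ?_
    obtain ⟨w, hw, rfl⟩ := hsub (interior_subset hz)
    simpa using (hs w hw).le
  have := hanti (left_mem_Icc.2 h) (right_mem_Icc.2 h) h
  linarith

/-- A nowhere vanishing continuous planar field on the plane has a continuous angle. -/
theorem exists_continuous_angle {G : ℝ × ℝ → ℂ} (hG : Continuous G) (h0 : ∀ z, G z ≠ 0) :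
    ∃ θ : ℝ × ℝ → ℝ, Continuous θ ∧
      ∀ z, (G z).re = ‖G z‖ * Real.cos (θ z) ∧ (G z).im = ‖G z‖ * Real.sin (θ z) := by
  let f : C(ℝ × ℝ, {z : ℂ // z ≠ 0}) := ⟨fun z => ⟨G z, h0 z⟩, by fun_prop⟩
  obtain ⟨F, ⟨-, hF⟩, -⟩ := Complex.isCoveringMap_exp.existsUnique_continuousMap_lifts f 0
    (Complex.log (G 0)) (Subtype.ext (Complex.exp_log (h0 0)))
  refine ⟨fun z => (F z).im, by fun_prop, fun z => ?_⟩
  have hz : Complex.exp (F z) = G z := congrArg Subtype.val (congrFun hF z)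
  rw [← hz, Complex.norm_exp, Complex.exp_re, Complex.exp_im]
  exact ⟨rfl, rfl⟩

/-- **Poincaré–Miranda theorem** on the square `[a, b]²`. -/
theorem poincare_miranda {a b : ℝ} (hab : a < b) {g₁ g₂ : ℝ → ℝ → ℝ}
    (h₁ : Continuous fun z : ℝ × ℝ => g₁ z.1 z.2) (h₂ : Continuous fun z : ℝ × ℝ => g₂ z.1 z.2)
    (hl : ∀ t ∈ Icc a b, 0 < g₁ a t) (hr : ∀ t ∈ Icc a b, g₁ b t < 0)
    (hb : ∀ s ∈ Icc a b, 0 < g₂ s a) (ht : ∀ s ∈ Icc a b, g₂ s b < 0) :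
    ∃ s ∈ Icc a b, ∃ t ∈ Icc a b, g₁ s t = 0 ∧ g₂ s t = 0 := by
  by_contra! hne
  let c : ℝ → ℝ := fun x => projIcc a b hab.le x
  have hc : Continuous c := by fun_prop
  have hcm : ∀ x, c x ∈ Icc a b := fun x => (projIcc a b hab.le x).2
  have hcid : ∀ x ∈ Icc a b, c x = x := fun x hx => by simp [c, projIcc_of_mem hab.le hx]
  have hca := hcid a (left_mem_Icc.2 hab.le)
  have hcb := hcid b (right_mem_Icc.2 hab.le)
  let G : ℝ × ℝ → ℂ := fun z => ⟨g₁ (c z.1) (c z.2), g₂ (c z.1) (c z.2)⟩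
  have hG : Continuous G := by
    have e1 : Continuous fun z : ℝ × ℝ => g₁ (c z.1) (c z.2) :=
      h₁.comp (f := fun z : ℝ × ℝ => (c z.1, c z.2)) (by fun_prop)
    have e2 : Continuous fun z : ℝ × ℝ => g₂ (c z.1) (c z.2) :=
      h₂.comp (f := fun z : ℝ × ℝ => (c z.1, c z.2)) (by fun_prop)
    have : G = fun z => Complex.equivRealProdCLM.symm (g₁ (c z.1) (c z.2), g₂ (c z.1) (c z.2)) := by
      funext z
      exact Complex.ext rfl rfl
    rw [this]
    exact Complex.equivRealProdCLM.symm.continuous.comp (e1.prodMk e2)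
  have hG0 : ∀ z, G z ≠ 0 := fun z hz =>
    hne _ (hcm z.1) _ (hcm z.2) (congrArg Complex.re hz) (congrArg Complex.im hz)
  obtain ⟨θ, hθ, hpol⟩ := exists_continuous_angle hG hG0
  have hpos : ∀ z, 0 < ‖G z‖ := fun z => norm_pos_iff.2 (hG0 z)
  have cpos : ∀ t, 0 < Real.cos (θ (a, t)) := fun t =>
    (mul_pos_iff_of_pos_left (hpos (a, t))).1
      (by rw [← (hpol (a, t)).1]; simpa [G, hca] using hl _ (hcm t))
  have cneg : ∀ t, Real.cos (θ (b, t)) < 0 := fun t =>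
    neg_of_mul_neg_right
      (by rw [← (hpol (b, t)).1]; simpa [G, hcb] using hr _ (hcm t)) (hpos (b, t)).le
  have spos : ∀ s, 0 < Real.sin (θ (s, a)) := fun s =>
    (mul_pos_iff_of_pos_left (hpos (s, a))).1
      (by rw [← (hpol (s, a)).2]; simpa [G, hca] using hb _ (hcm s))
  have sneg : ∀ s, Real.sin (θ (s, b)) < 0 := fun s =>
    neg_of_mul_neg_right
      (by rw [← (hpol (s, b)).2]; simpa [G, hcb] using ht _ (hcm s)) (hpos (s, b)).le
  -- The angle increases along each side, run counterclockwise.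
  have k1 : θ (a, a) < θ (b, a) :=
    angle_lt_of_sin_pos (φ := fun s => θ (s, a)) (by fun_prop) (fun s _ => spos s) (cpos a) (cneg a)
  have k2 : θ (b, a) - Real.pi / 2 < θ (b, b) - Real.pi / 2 :=
    angle_lt_of_sin_pos (φ := fun t => θ (b, t) - Real.pi / 2) (by fun_prop)
      (fun t _ => by rw [Real.sin_sub_pi_div_two]; linarith [cneg t])
      (by rw [Real.cos_sub_pi_div_two]; exact spos b) (by rw [Real.cos_sub_pi_div_two]; exact sneg b)
  have k3 : θ (b, b) - Real.pi < θ (a, b) - Real.pi :=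
    angle_lt_of_sin_pos (φ := fun s => θ (s, b) - Real.pi) (by fun_prop)
      (fun s _ => by rw [Real.sin_sub_pi]; linarith [sneg s])
      (by rw [Real.cos_sub_pi]; linarith [cneg b]) (by rw [Real.cos_sub_pi]; linarith [cpos b])
  have k4 : θ (a, b) + Real.pi / 2 < θ (a, a) + Real.pi / 2 :=
    angle_lt_of_sin_pos (φ := fun t => θ (a, t) + Real.pi / 2) (by fun_prop)
      (fun t _ => by rw [Real.sin_add_pi_div_two]; exact cpos t)
      (by rw [Real.cos_add_pi_div_two]; linarith [sneg a])
      (by rw [Real.cos_add_pi_div_two]; linarith [spos a])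
  linarith

/-! ### Mollification -/

/-- Jensen's inequality for the square and a density `r` of total mass one. -/
theorem sq_lintegral_mul_le {α : Type*} [MeasurableSpace α] {μ : Measure α} {r f : α → ENNReal}
    (hr : AEMeasurable r μ) (hf : AEMeasurable f μ) (h1 : ∫⁻ x, r x ∂μ = 1) :
    (∫⁻ x, r x * f x ∂μ) ^ 2 ≤ ∫⁻ x, r x * f x ^ 2 ∂μ := by
  have key := ENNReal.lintegral_mul_norm_pow_le (μ := μ) hr (hr.mul (hf.pow_const 2))
    (p := 1 / 2) (q := 1 / 2) (by norm_num) (by norm_num) (by norm_num)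
  have e : ∀ x, r x ^ (1 / 2 : ℝ) * (r x * f x ^ 2) ^ (1 / 2 : ℝ) = r x * f x := by
    intro x
    have hh : ∀ a : ENNReal, (a ^ 2) ^ (1 / 2 : ℝ) = a := fun a => by
      rw [← ENNReal.rpow_natCast, ← ENNReal.rpow_mul]; norm_num
    rw [← ENNReal.mul_rpow_of_nonneg _ _ (by norm_num), ← mul_assoc, ← sq, ← mul_pow, hh]
  simp only [Pi.mul_apply] at key
  simp_rw [e] at key
  rw [h1, ENNReal.one_rpow, one_mul] at key
  calc (∫⁻ x, r x * f x ∂μ) ^ 2 ≤ ((∫⁻ x, r x * f x ^ 2 ∂μ) ^ (1 / 2 : ℝ)) ^ 2 := by gcongr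
    _ = ∫⁻ x, r x * f x ^ 2 ∂μ := by
      rw [← ENNReal.rpow_natCast, ← ENNReal.rpow_mul]; norm_num

section Mollify

variable {F : Type*} [NormedAddCommGroup F] [NormedSpace ℝ F]

/-- The mollification of `u` by the normalised bump function `φ`. -/
noncomputable def mollify (φ : ContDiffBump (0 : E3)) (u : E3 → F) : E3 → F :=
  convolution (φ.normed volume) u (ContinuousLinearMap.lsmul ℝ ℝ) volume

theorem lintegral_mollify_sq_le (φ : ContDiffBump (0 : E3)) {u : E3 → F}
    (hu : AEStronglyMeasurable u volume) :
    ∫⁻ x, ‖mollify φ u x‖ₑ ^ 2 ≤ ∫⁻ x, ‖u x‖ₑ ^ 2 := by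
  set r : E3 → ENNReal := fun t => ‖φ.normed volume t‖ₑ with hr
  have hrm : Measurable r := φ.continuous_normed.enorm.measurable
  have h1 : ∫⁻ t, r t = 1 := by
    have := ofReal_integral_eq_lintegral_ofReal (φ.integrable_normed (μ := volume))
      (Eventually.of_forall φ.nonneg_normed)
    rw [φ.integral_normed, ENNReal.ofReal_one] at this
    rw [this]
    refine lintegral_congr fun t => ?_
    exact Real.enorm_eq_ofReal (φ.nonneg_normed t)
  have hq : ∀ x, Measure.QuasiMeasurePreserving (fun t : E3 => x - t) volume volume := fun x =>
    (Measure.measurePreserving_sub_left volume x).quasiMeasurePreserving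
  calc ∫⁻ x, ‖mollify φ u x‖ₑ ^ 2 ≤ ∫⁻ x, ∫⁻ t, r t * ‖u (x - t)‖ₑ ^ 2 := by
        refine lintegral_mono fun x => ?_
        refine le_trans ?_ (sq_lintegral_mul_le hrm.aemeasurable
          ((hu.comp_quasiMeasurePreserving (hq x)).enorm) h1)
        gcongr
        refine (enorm_integral_le_lintegral_enorm _).trans (le_of_eq ?_)
        simp [hr, enorm_smul]
    _ = ∫⁻ t, ∫⁻ x, r t * ‖u (x - t)‖ₑ ^ 2 := by
        refine lintegral_lintegral_swap ?_
        have h2 : AEMeasurable (fun z : E3 × E3 => ‖u (z.1 - z.2)‖ₑ) (volume.prod volume) :=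
          (hu.comp_quasiMeasurePreserving (quasiMeasurePreserving_sub volume volume)).enorm
        exact (hrm.comp measurable_snd).aemeasurable.mul (h2.pow_const 2)
    _ = ∫⁻ t, r t * ∫⁻ x, ‖u x‖ₑ ^ 2 := by
        refine lintegral_congr fun t => ?_
        have hm : AEMeasurable (fun x => ‖u (x - t)‖ₑ ^ 2) volume :=
          ((hu.comp_quasiMeasurePreserving
            (measurePreserving_sub_right volume t).quasiMeasurePreserving).enorm).pow_const 2
        rw [lintegral_const_mul'' _ hm, lintegral_sub_right_eq_self (fun x => ‖u x‖ₑ ^ 2) t]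
    _ = ∫⁻ x, ‖u x‖ₑ ^ 2 := by
        rw [lintegral_mul_const _ hrm, h1, one_mul]

theorem contDiff_mollify (φ : ContDiffBump (0 : E3)) {u : E3 → F}
    (hu : LocallyIntegrable u volume) : ContDiff ℝ ∞ (mollify φ u) :=
  φ.hasCompactSupport_normed.contDiff_convolution_left _ (n := ⊤) φ.contDiff_normed hu

end Mollify

/-- The gradient of a mollification is the mollification of the weak gradient. -/
theorem fderiv_mollify (φ : ContDiffBump (0 : E3)) {u : E3 → ℝ} {g : E3 → E3}
    (hu : LocallyIntegrable u volume) (hg : LocallyIntegrable g volume)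
    (hug : IsWeakGradient u g) (x v : E3) :
    fderiv ℝ (mollify φ u) x v = inner ℝ (mollify φ g x) v := by
  -- the test function is `y ↦ ρ (x - y)`
  set ρ := φ.normed (volume : Measure E3)
  have hρ : ContDiff ℝ ∞ ρ := φ.contDiff_normed (n := ⊤)
  have hc : HasCompactSupport ρ := φ.hasCompactSupport_normed
  have hρ1 : ContDiff ℝ 1 ρ := hρ.of_le (by exact_mod_cast le_top)
  have hd := hc.hasFDerivAt_convolution_left (ContinuousLinearMap.lsmul ℝ ℝ) hρ1 hu x
  have hex := (hc.fderiv ℝ).convolutionExists_left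
    ((ContinuousLinearMap.lsmul ℝ ℝ).precompL E3) (hρ1.continuous_fderiv one_ne_zero) hu x
  have hexg := hc.convolutionExists_left (ContinuousLinearMap.lsmul ℝ ℝ (E := E3))
    hρ.continuous hg x
  have e1 : fderiv ℝ (mollify φ u) x v = ∫ t, fderiv ℝ ρ t v * u (x - t) := by
    rw [show fderiv ℝ (mollify φ u) x = _ from hd.fderiv, convolution_def,
      ContinuousLinearMap.integral_apply hex]
    rfl
  have e2 : inner ℝ (mollify φ g x) v = ∫ t, inner ℝ (g (x - t)) v * ρ t := by
    rw [real_inner_comm, mollify, convolution_def, ← integral_inner hexg]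
    refine integral_congr_ae (Eventually.of_forall fun t => ?_)
    simp only [ContinuousLinearMap.lsmul_apply, real_inner_smul_right, real_inner_comm v]
    ring
  have hψ : ContDiff ℝ ∞ (fun y => ρ (x - y)) := hρ.comp (contDiff_const.sub contDiff_id)
  have hψc : HasCompactSupport (fun y => ρ (x - y)) :=
    hc.comp_homeomorph (Homeomorph.subLeft x)
  have hψd : ∀ y, fderiv ℝ (fun y => ρ (x - y)) y v = - fderiv ℝ ρ (x - y) v := by
    intro y
    have h := ((hρ1.differentiable one_ne_zero (x - y)).hasFDerivAt).comp y
      ((hasFDerivAt_const x y).sub (hasFDerivAt_id y))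
    rw [show fderiv ℝ (fun y => ρ (x - y)) y = _ from h.fderiv]
    simp
  have key := hug _ hψ hψc v
  rw [e1, e2, ← integral_sub_left_eq_self _ volume x, ← integral_sub_left_eq_self
    (fun t => inner ℝ (g (x - t)) v * ρ t) volume x]
  simp only [sub_sub_cancel]
  simp only [hψd, mul_neg, integral_neg, neg_inj] at key
  rw [← key]
  simp only [mul_comm]

/-- If `uₙ → u` almost everywhere and the `L²` norms do not exceed that of `u`, then `uₙ → u`
in `L²`: Fatou's lemma for `2|uₙ|² + 2|u|² - |uₙ - u|²`. -/
theorem tendsto_lintegral_sub_sq {α F : Type*} [MeasurableSpace α] {μ : Measure α}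
    [NormedAddCommGroup F] {U : ℕ → α → F} {u : α → F}
    (hU : ∀ n, AEStronglyMeasurable (U n) μ) (hu : AEStronglyMeasurable u μ)
    (hfin : ∫⁻ x, ‖u x‖ₑ ^ 2 ∂μ ≠ ⊤) (hle : ∀ n, ∫⁻ x, ‖U n x‖ₑ ^ 2 ∂μ ≤ ∫⁻ x, ‖u x‖ₑ ^ 2 ∂μ)
    (hae : ∀ᵐ x ∂μ, Tendsto (fun n => U n x) atTop (𝓝 (u x))) :
    Tendsto (fun n => ∫⁻ x, ‖U n x - u x‖ₑ ^ 2 ∂μ) atTop (𝓝 0) := by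
  let s : ℕ → α → ENNReal := fun n x => 2 * ‖U n x‖ₑ ^ 2 + 2 * ‖u x‖ₑ ^ 2
  let d : ℕ → α → ENNReal := fun n x => ‖U n x - u x‖ₑ ^ 2
  have hds : ∀ n x, d n x ≤ s n x := by
    intro n x
    have h : ‖U n x - u x‖ₑ ≤ ‖U n x‖ₑ + ‖u x‖ₑ := enorm_sub_le
    have h2 : (‖U n x‖ₑ + ‖u x‖ₑ) ^ 2 ≤ 2 * ‖U n x‖ₑ ^ 2 + 2 * ‖u x‖ₑ ^ 2 := by
      simp only [enorm_eq_nnnorm]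
      norm_cast
      rw [← mul_add]
      exact add_sq_le
    exact (pow_le_pow_left' h 2).trans h2
  have hUm : ∀ n, AEMeasurable (fun x => ‖U n x‖ₑ ^ 2) μ := fun n => (hU n).enorm.pow_const 2
  have hum : AEMeasurable (fun x => ‖u x‖ₑ ^ 2) μ := hu.enorm.pow_const 2
  have hdm : ∀ n, AEMeasurable (d n) μ := fun n => ((hU n).sub hu).enorm.pow_const 2
  have hsm : ∀ n, AEMeasurable (s n) μ := fun n => ((hUm n).const_mul 2).add (hum.const_mul 2)
  set I : ENNReal := 4 * ∫⁻ x, ‖u x‖ₑ ^ 2 ∂μ with hI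
  have hItop : I ≠ ⊤ := ENNReal.mul_ne_top (by norm_num) hfin
  have hsum : ∀ n, ∫⁻ x, (s n x - d n x) ∂μ + ∫⁻ x, d n x ∂μ ≤ I := by
    intro n
    rw [← lintegral_add_right' _ (hdm n)]
    calc ∫⁻ x, (s n x - d n x + d n x) ∂μ = ∫⁻ x, s n x ∂μ :=
          lintegral_congr fun x => tsub_add_cancel_of_le (hds n x)
      _ = 2 * ∫⁻ x, ‖U n x‖ₑ ^ 2 ∂μ + 2 * ∫⁻ x, ‖u x‖ₑ ^ 2 ∂μ := by
          rw [lintegral_add_left' ((hUm n).const_mul 2), lintegral_const_mul'' _ (hUm n),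
            lintegral_const_mul'' _ hum]
      _ ≤ 2 * ∫⁻ x, ‖u x‖ₑ ^ 2 ∂μ + 2 * ∫⁻ x, ‖u x‖ₑ ^ 2 ∂μ := by
          gcongr 2 * ?_ + _
          exact hle n
      _ = I := by rw [hI, ← add_mul]; norm_num
  have hfatou : I ≤ liminf (fun n => ∫⁻ x, (s n x - d n x) ∂μ) atTop := by
    refine le_trans (le_of_eq ?_) (lintegral_liminf_le' fun n => (hsm n).sub (hdm n))
    rw [hI, ← lintegral_const_mul'' _ hum]
    refine lintegral_congr_ae ?_
    filter_upwards [hae] with x hx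
    have h1 : Tendsto (fun n => s n x) atTop (𝓝 (2 * ‖u x‖ₑ ^ 2 + 2 * ‖u x‖ₑ ^ 2)) := by
      refine Tendsto.add (ENNReal.Tendsto.const_mul ?_ (by norm_num)) tendsto_const_nhds
      exact (ENNReal.continuous_pow 2).continuousAt.tendsto.comp hx.enorm
    have h2 : Tendsto (fun n => d n x) atTop (𝓝 0) := by
      have : Tendsto (fun n => ‖U n x - u x‖ₑ) atTop (𝓝 ‖u x - u x‖ₑ) :=
        (hx.sub_const (u x)).enorm
      have := (ENNReal.continuous_pow 2).continuousAt.tendsto.comp this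
      simpa [d, Function.comp_def] using this
    have h3 := ENNReal.Tendsto.sub h1 h2 (Or.inr (by norm_num))
    refine Eq.trans ?_ h3.liminf_eq.symm
    rw [tsub_zero, ← add_mul]
    norm_num
  rw [ENNReal.tendsto_nhds_zero]
  intro ε hε
  by_cases hI0 : I = 0
  · refine Eventually.of_forall fun n => ?_
    have := le_trans le_add_self (hsum n)
    rw [hI0] at this
    exact this.trans zero_le
  · have hlt : I - ε < I := ENNReal.sub_lt_self hItop hI0 hε.ne'
    filter_upwards [eventually_lt_of_lt_liminf (hlt.trans_le hfatou)] with n hn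
    have hA : ∫⁻ x, (s n x - d n x) ∂μ ≠ ⊤ :=
      ne_top_of_le_ne_top hItop (le_trans le_self_add (hsum n))
    have h1 : I ≤ ε + ∫⁻ x, (s n x - d n x) ∂μ := by
      rw [add_comm]
      exact tsub_le_iff_right.1 hn.le
    have h2 := (hsum n).trans h1
    rw [add_comm] at h2
    exact (ENNReal.add_le_add_iff_right hA).1 h2

/-- Smooth approximation of a pair `(u, ∇u)` in `L²`, almost everywhere and in norm. -/
theorem exists_smooth_approx {u : E3 → ℝ} {g : E3 → E3} (hu : MemLp u 2 volume)
    (hg : MemLp g 2 volume) (hug : IsWeakGradient u g) :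
    ∃ (U : ℕ → E3 → ℝ) (V : ℕ → E3 → E3), (∀ n, ContDiff ℝ ∞ (U n)) ∧ (∀ n, Continuous (V n)) ∧
      (∀ n x v, fderiv ℝ (U n) x v = inner ℝ (V n x) v) ∧
      (∀ n, ∫⁻ x, ‖U n x‖ₑ ^ 2 ≤ ∫⁻ x, ‖u x‖ₑ ^ 2) ∧
      (∀ n, ∫⁻ x, ‖V n x‖ₑ ^ 2 ≤ ∫⁻ x, ‖g x‖ₑ ^ 2) ∧
      (∀ᵐ x, Tendsto (fun n => U n x) atTop (𝓝 (u x))) ∧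
      (∀ᵐ x, Tendsto (fun n => V n x) atTop (𝓝 (g x))) := by
  let φ : ℕ → ContDiffBump (0 : E3) := fun n =>
    ⟨1 / ((n : ℝ) + 1), 2 * (1 / ((n : ℝ) + 1)), by positivity, by
      have : 0 < 1 / ((n : ℝ) + 1) := by positivity
      linarith⟩
  have hφ : Tendsto (fun n => (φ n).rOut) atTop (𝓝 0) := by
    simpa [φ] using (tendsto_one_div_add_atTop_nhds_zero_nat (𝕜 := ℝ)).const_mul 2
  have hu' := hu.locallyIntegrable (by norm_num)
  have hg' := hg.locallyIntegrable (by norm_num)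
  refine ⟨fun n => mollify (φ n) u, fun n => mollify (φ n) g, fun n => contDiff_mollify _ hu',
    fun n => (contDiff_mollify _ hg').continuous, fun n => fderiv_mollify _ hu' hg' hug,
    fun n => lintegral_mollify_sq_le _ hu.1, fun n => lintegral_mollify_sq_le _ hg.1,
    ContDiffBump.ae_convolution_tendsto_right_of_locallyIntegrable (K := 2) hφ
      (Eventually.of_forall fun n => le_rfl) hu',
    ContDiffBump.ae_convolution_tendsto_right_of_locallyIntegrable (K := 2) hφ
      (Eventually.of_forall fun n => le_rfl) hg'⟩

/-! ### The Sobolev inequality -/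

theorem eLpNorm_natCast_pow {α F : Type*} [MeasurableSpace α] {μ : Measure α}
    [NormedAddCommGroup F] (u : α → F) {n : ℕ} (hn : n ≠ 0) :
    eLpNorm u n μ ^ n = ∫⁻ x, ‖u x‖ₑ ^ n ∂μ := by
  rw [eLpNorm_eq_lintegral_rpow_enorm_toReal (by exact_mod_cast hn) (by simp)]
  simp only [ENNReal.toReal_natCast]
  rw [← ENNReal.rpow_natCast, ← ENNReal.rpow_mul]
  simp [hn]

theorem eLpNorm_two_sq {α F : Type*} [MeasurableSpace α] {μ : Measure α}
    [NormedAddCommGroup F] (u : α → F) : eLpNorm u 2 μ ^ 2 = ∫⁻ x, ‖u x‖ₑ ^ 2 ∂μ :=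
  eLpNorm_natCast_pow u two_ne_zero

theorem eLpNorm_two_le_of_lintegral_le {α F G : Type*} [MeasurableSpace α] {μ : Measure α}
    [NormedAddCommGroup F] [NormedAddCommGroup G] {u : α → F} {v : α → G}
    (h : ∫⁻ x, ‖u x‖ₑ ^ 2 ∂μ ≤ ∫⁻ x, ‖v x‖ₑ ^ 2 ∂μ) : eLpNorm u 2 μ ≤ eLpNorm v 2 μ := by
  rw [← eLpNorm_two_sq, ← eLpNorm_two_sq] at h
  exact (ENNReal.pow_le_pow_left_iff two_ne_zero).1 h

/-- A family of smooth cutoff functions with uniformly bounded gradients, tending to `1`. -/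
theorem exists_cutoff : ∃ (χ : ℕ → E3 → ℝ) (M : NNReal), (∀ n, ContDiff ℝ ∞ (χ n)) ∧
    (∀ n, HasCompactSupport (χ n)) ∧ (∀ n x, ‖χ n x‖ ≤ 1) ∧ (∀ n x, ‖fderiv ℝ (χ n) x‖ ≤ M) ∧
    ∀ x, Tendsto (fun n => χ n x) atTop (𝓝 1) := by
  let φ : ContDiffBump (0 : E3) := ⟨1, 2, one_pos, one_lt_two⟩
  have hφ : ContDiff ℝ ∞ φ := φ.contDiff
  obtain ⟨M, hM⟩ := (φ.hasCompactSupport.fderiv ℝ).exists_bound_of_continuous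
    (hφ.continuous_fderiv (by simp))
  let r : ℕ → ℝ := fun n => 1 / ((n : ℝ) + 1)
  have hr0 : ∀ n, 0 < r n := fun n => by positivity
  have hr1 : ∀ n, r n ≤ 1 := fun n => by
    rw [div_le_one (by positivity)]
    have : (0 : ℝ) ≤ n := n.cast_nonneg
    linarith
  have hr : Tendsto r atTop (𝓝 0) := tendsto_one_div_add_atTop_nhds_zero_nat
  refine ⟨fun n x => φ (r n • x), M.toNNReal, fun n => hφ.comp (contDiff_id.const_smul (r n)),
    fun n => φ.hasCompactSupport.comp_smul (hr0 n).ne', fun n x => ?_, fun n x => ?_, fun x => ?_⟩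
  · rw [Real.norm_of_nonneg φ.nonneg]
    exact φ.le_one
  · have h := (hφ.differentiable (by simp) (r n • x)).hasFDerivAt.comp x
      ((hasFDerivAt_id x).const_smul (r n))
    rw [show fderiv ℝ (fun x => φ (r n • x)) x = _ from h.fderiv]
    simp only [ContinuousLinearMap.comp_smul, norm_smul, Real.norm_of_nonneg (hr0 n).le]
    have h1 : ‖(fderiv ℝ φ (r n • x)).comp (ContinuousLinearMap.id ℝ E3)‖ ≤ M := by
      simpa using hM (r n • x)
    calc r n * _ ≤ 1 * M := by
          gcongr
          exact hr1 n
      _ ≤ _ := by rw [one_mul]; exact Real.le_coe_toNNReal M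
  · have h1 : Tendsto (fun n => r n • x) atTop (𝓝 0) := by simpa using hr.smul_const x
    have h2 := (φ.continuous.tendsto 0).comp h1
    rwa [φ.one_of_mem_closedBall (by simp [φ])] at h2

/-- The Sobolev inequality `|u|₆ ≤ K (|u|₂ + |∇u|₂)` for weak gradients. -/
theorem exists_eLpNorm_six_le : ∃ K : NNReal, ∀ (u : E3 → ℝ) (g : E3 → E3), MemLp u 2 volume →
    MemLp g 2 volume → IsWeakGradient u g →
    eLpNorm u 6 volume ≤ K * (eLpNorm u 2 volume + eLpNorm g 2 volume) := by
  obtain ⟨χ, M, hχ, hχc, hχ1, hχd, hχt⟩ := exists_cutoff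
  let C : NNReal := eLpNormLESNormFDerivOfEqInnerConst (volume : Measure E3) 2
  refine ⟨C * (M + 1), fun u g hu hg hug => ?_⟩
  obtain ⟨U, V, hU, hV, hUV, hUle, hVle, hUt, -⟩ := exists_smooth_approx hu hg hug
  have hbound : ∀ n, eLpNorm (fun x => χ n x * U n x) 6 volume ≤
      (C * (M + 1) : NNReal) * (eLpNorm u 2 volume + eLpNorm g 2 volume) := by
    intro n
    have hsm : ContDiff ℝ 1 (fun x => χ n x * U n x) :=
      ((hχ n).mul (hU n)).of_le (by exact_mod_cast le_top)
    have h6 := eLpNorm_le_eLpNorm_fderiv_of_eq_inner (volume : Measure E3) hsm (hχc n).mul_right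
      (p := 2) (p' := 6) (by norm_num) (by simp) (by simp; norm_num)
    refine h6.trans ?_
    have hd : ∀ x, ‖fderiv ℝ (fun x => χ n x * U n x) x‖ ≤ ‖(M : ℝ) * ‖U n x‖ + ‖V n x‖‖ := by
      intro x
      have hVn : ‖fderiv ℝ (U n) x‖ ≤ ‖V n x‖ :=
        ContinuousLinearMap.opNorm_le_bound _ (norm_nonneg _) fun v => by
          rw [hUV]; exact norm_inner_le_norm _ _
      rw [fderiv_fun_mul ((hχ n).differentiable (by simp) x) ((hU n).differentiable (by simp) x),
        Real.norm_of_nonneg (by positivity : (0 : ℝ) ≤ (M : ℝ) * ‖U n x‖ + ‖V n x‖)]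
      refine (norm_add_le _ _).trans ?_
      rw [norm_smul, norm_smul, add_comm, mul_comm (M : ℝ)]
      gcongr
      · exact hχd n x
      · calc ‖χ n x‖ * ‖fderiv ℝ (U n) x‖ ≤ 1 * ‖V n x‖ := by gcongr; exact hχ1 n x
          _ = _ := one_mul _
    have hUc : Continuous (U n) := (hU n).continuous
    calc (C : ENNReal) * eLpNorm (fderiv ℝ fun x => χ n x * U n x) 2 volume
        ≤ C * (M * eLpNorm (U n) 2 volume + eLpNorm (V n) 2 volume) := by
          gcongr
          refine (eLpNorm_mono hd).trans ?_
          refine (eLpNorm_add_le (by fun_prop) (by fun_prop) (by norm_num)).trans ?_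
          have hc := eLpNorm_const_smul (M : ℝ) (fun x => ‖U n x‖) 2 (volume : Measure E3)
          rw [eLpNorm_norm] at hc
          rw [eLpNorm_norm]
          gcongr
          refine le_of_eq (hc.trans ?_)
          simp
      _ ≤ C * (M * eLpNorm u 2 volume + eLpNorm g 2 volume) := by
          gcongr
          · exact eLpNorm_two_le_of_lintegral_le (hUle n)
          · exact eLpNorm_two_le_of_lintegral_le (hVle n)
      _ ≤ C * ((M + 1) * (eLpNorm u 2 volume + eLpNorm g 2 volume)) := by
          gcongr
          rw [mul_add]
          gcongr
          · exact le_self_add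
          · exact le_mul_of_one_le_left zero_le le_add_self
      _ = _ := by push_cast; ring
  refine (Lp.eLpNorm_lim_le_liminf_eLpNorm
    (f := fun n x => χ n x * U n x) (fun n => ?_) u ?_).trans ?_
  · exact ((hχ n).continuous.mul (hU n).continuous).aestronglyMeasurable
  · filter_upwards [hUt] with x hx
    simpa using (hχt x).mul hx
  · exact liminf_le_of_le (by isBoundedDefault) fun b hb => by
      obtain ⟨n, hn⟩ := hb.exists
      exact hn.trans (hbound n)

/-- The embedding `H¹ ⊂ L⁴`, by interpolation between `L²` and `L⁶`. -/
theorem exists_lintegral_four_le : ∃ K : NNReal, ∀ (u : E3 → ℝ) (g : E3 → E3), MemLp u 2 volume →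
    MemLp g 2 volume → IsWeakGradient u g →
    ∫⁻ x, ‖u x‖ₑ ^ 4 ≤ K * (eLpNorm u 2 volume + eLpNorm g 2 volume) ^ 4 := by
  obtain ⟨K, hK⟩ := exists_eLpNorm_six_le
  refine ⟨K ^ 3, fun u g hu hg hug => ?_⟩
  have hm : AEMeasurable (fun x => ‖u x‖ₑ) volume := hu.1.enorm
  have h := ENNReal.lintegral_mul_le_Lp_mul_Lq volume Real.HolderConjugate.two_two hm
    (hm.pow_const 3)
  have e1 : ∀ x, ((fun x => ‖u x‖ₑ) * fun x => ‖u x‖ₑ ^ 3) x = ‖u x‖ₑ ^ 4 := fun x => by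
    simp only [Pi.mul_apply]; ring
  have e2 : (∫⁻ x, ‖u x‖ₑ ^ (2 : ℝ)) ^ (1 / 2 : ℝ) = eLpNorm u 2 volume := by
    rw [eLpNorm_eq_lintegral_rpow_enorm_toReal (by norm_num) (by norm_num)]
    simp
  have e3 : (∫⁻ x, (‖u x‖ₑ ^ 3) ^ (2 : ℝ)) ^ (1 / 2 : ℝ) = eLpNorm u 6 volume ^ 3 := by
    have e4 : ∀ x, (‖u x‖ₑ ^ 3) ^ (2 : ℝ) = ‖u x‖ₑ ^ 6 := fun x => by
      rw [ENNReal.rpow_ofNat, ← pow_mul]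
    simp_rw [e4]
    have := eLpNorm_natCast_pow (μ := volume) u (n := 6) (by norm_num)
    rw [← this]
    simp only [Nat.cast_ofNat]
    rw [← ENNReal.rpow_natCast, ← ENNReal.rpow_mul, ← ENNReal.rpow_natCast]
    norm_num
  simp_rw [e1] at h
  rw [e2, e3] at h
  refine h.trans ?_
  calc eLpNorm u 2 volume * eLpNorm u 6 volume ^ 3
      ≤ (eLpNorm u 2 volume + eLpNorm g 2 volume) *
        (K * (eLpNorm u 2 volume + eLpNorm g 2 volume)) ^ 3 := by
        gcongr
        · exact le_self_add
        · exact hK u g hu hg hug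
    _ = _ := by push_cast; ring

/-! ### The chain rule for weak gradients -/

/-- Dominated convergence with a dominating sequence `eₙ + b`, where `eₙ → 0` in mean. -/
theorem tendsto_integral_of_le_add {α : Type*} [MeasurableSpace α] {μ : Measure α}
    {f : ℕ → α → ℝ} {f₀ : α → ℝ} {e : ℕ → α → ℝ} {b : α → ℝ} (hf : ∀ n, Integrable (f n) μ)
    (hf₀ : Integrable f₀ μ) (he : ∀ n, Integrable (e n) μ) (he0 : ∀ n x, 0 ≤ e n x)
    (hb : Integrable b μ) (hle : ∀ n, ∀ᵐ x ∂μ, |f n x - f₀ x| ≤ e n x + b x)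
    (hlim : Tendsto (fun n => ∫ x, e n x ∂μ) atTop (𝓝 0))
    (hae : ∀ᵐ x ∂μ, Tendsto (fun n => f n x) atTop (𝓝 (f₀ x))) :
    Tendsto (fun n => ∫ x, f n x ∂μ) atTop (𝓝 (∫ x, f₀ x ∂μ)) := by
  have hdi : ∀ n, Integrable (fun x => |f n x - f₀ x|) μ := fun n => ((hf n).sub hf₀).abs
  have hmi : ∀ n, Integrable (fun x => min |f n x - f₀ x| |b x|) μ := fun n =>
    (hdi n).inf hb.abs
  have hmin : Tendsto (fun n => ∫ x, min |f n x - f₀ x| |b x| ∂μ) atTop (𝓝 0) := by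
    have := tendsto_integral_of_dominated_convergence (f := fun _ => (0 : ℝ)) (fun x => |b x|)
      (fun n => (hmi n).1) hb.abs (fun n => Eventually.of_forall fun x => ?_) ?_
    · simpa using this
    · rw [Real.norm_of_nonneg (le_min (abs_nonneg _) (abs_nonneg _))]
      exact min_le_right _ _
    · filter_upwards [hae] with x hx
      have h1 : Tendsto (fun n => |f n x - f₀ x|) atTop (𝓝 0) := by
        simpa using (hx.sub_const (f₀ x)).abs
      simpa using h1.min (tendsto_const_nhds (x := |b x|))
  rw [tendsto_iff_norm_sub_tendsto_zero]
  refine squeeze_zero (fun n => norm_nonneg _) (fun n => ?_) (by simpa using hlim.add hmin)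
  rw [← integral_sub (hf n) hf₀, ← integral_add (he n) (hmi n)]
  refine (norm_integral_le_integral_norm _).trans
    (integral_mono_ae (hdi n) ((he n).add (hmi n)) ?_)
  filter_upwards [hle n] with x hx
  simp only [Real.norm_eq_abs]
  rcases le_total |f n x - f₀ x| |b x| with h | h
  · rw [min_eq_left h]
    linarith [he0 n x]
  · rw [min_eq_right h]
    linarith [le_abs_self (b x)]

theorem MeasureTheory.MemLp.integrable_norm_sq {α F : Type*} [MeasurableSpace α] {μ : Measure α}
    [NormedAddCommGroup F] {u : α → F} (hu : MemLp u 2 μ) : Integrable (fun x => ‖u x‖ ^ 2) μ := by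
  simpa using hu.integrable_norm_pow two_ne_zero

theorem tendsto_integral_norm_sub_sq {α F : Type*} [MeasurableSpace α] {μ : Measure α}
    [NormedAddCommGroup F] {U : ℕ → α → F} {u : α → F} (hU : ∀ n, MemLp (U n) 2 μ)
    (hu : MemLp u 2 μ) (hle : ∀ n, ∫⁻ x, ‖U n x‖ₑ ^ 2 ∂μ ≤ ∫⁻ x, ‖u x‖ₑ ^ 2 ∂μ)
    (hae : ∀ᵐ x ∂μ, Tendsto (fun n => U n x) atTop (𝓝 (u x))) :
    Tendsto (fun n => ∫ x, ‖U n x - u x‖ ^ 2 ∂μ) atTop (𝓝 0) := by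
  have hfin : ∫⁻ x, ‖u x‖ₑ ^ 2 ∂μ ≠ ⊤ := by
    rw [← eLpNorm_two_sq]
    exact ENNReal.pow_ne_top hu.2.ne
  have h := tendsto_lintegral_sub_sq (fun n => (hU n).1) hu.1 hfin hle hae
  have h2 := (ENNReal.tendsto_toReal ENNReal.zero_ne_top).comp h
  simp only [ENNReal.toReal_zero] at h2
  refine h2.congr fun n => ?_
  have hint : Integrable (fun x => ‖U n x - u x‖ ^ 2) μ := ((hU n).sub hu).integrable_norm_sq
  rw [integral_eq_lintegral_of_nonneg_ae (Eventually.of_forall fun x => by positivity) hint.1]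
  simp only [Function.comp]
  congr 1
  refine lintegral_congr fun x => ?_
  rw [ENNReal.ofReal_pow (norm_nonneg _), ofReal_norm]

theorem memLp_two_of_lintegral_le {α F : Type*} [MeasurableSpace α] {μ : Measure α}
    [NormedAddCommGroup F] {U u : α → F} (hU : AEStronglyMeasurable U μ) (hu : MemLp u 2 μ)
    (hle : ∫⁻ x, ‖U x‖ₑ ^ 2 ∂μ ≤ ∫⁻ x, ‖u x‖ₑ ^ 2 ∂μ) : MemLp U 2 μ :=
  ⟨hU, (eLpNorm_two_le_of_lintegral_le hle).trans_lt hu.2⟩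

theorem memLp_testDeriv {ψ : E3 → ℝ} (hψ : ContDiff ℝ ∞ ψ) (hc : HasCompactSupport ψ) (v : E3) :
    MemLp (fun x => fderiv ℝ ψ x v) 2 volume :=
  ((hψ.continuous_fderiv (by simp)).clm_apply continuous_const).memLp_of_hasCompactSupport
    (hc.fderiv_apply ℝ v)

theorem integrable_comp_mul {G : ℝ → ℝ} (hG : Continuous G) {C : ℝ}
    (hGb : ∀ t, |G t| ≤ |t| + C) {u : E3 → ℝ} (hu : MemLp u 2 volume) {ψ : E3 → ℝ}
    (hψ : Continuous ψ) (hc : HasCompactSupport ψ) :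
    Integrable (fun x => G (u x) * ψ x) := by
  have h1 : Integrable (fun x => |u x| * |ψ x|) :=
    MemLp.integrable_mul (p := 2) (q := 2) hu.abs (hψ.memLp_of_hasCompactSupport hc).abs
  have h2 : Integrable (fun x => |u x| * |ψ x| + C * |ψ x|) :=
    h1.add ((hψ.integrable_of_hasCompactSupport hc).abs.const_mul C)
  refine h2.mono' ((hG.comp_aestronglyMeasurable hu.1).mul hψ.aestronglyMeasurable)
    (Eventually.of_forall fun x => ?_)
  rw [norm_mul, Real.norm_eq_abs, Real.norm_eq_abs, ← add_mul]
  exact mul_le_mul_of_nonneg_right (hGb _) (abs_nonneg _)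

theorem integrable_comp_inner_mul {d : ℝ → ℝ} (hd : Measurable d) (hd1 : ∀ t, |d t| ≤ 1)
    {u : E3 → ℝ} (hu : AEStronglyMeasurable u volume) {g : E3 → E3} (hg : MemLp g 2 volume)
    (v : E3) {ψ : E3 → ℝ} (hψ : Continuous ψ) (hc : HasCompactSupport ψ) :
    Integrable (fun x => d (u x) * inner ℝ (g x) v * ψ x) := by
  have h1 : Integrable (fun x => inner ℝ (g x) v * ψ x) :=
    MemLp.integrable_mul (p := 2) (q := 2) (hg.inner_const v) (hψ.memLp_of_hasCompactSupport hc)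
  have := h1.bdd_mul (c := 1) (hd.comp_aemeasurable hu.aemeasurable).aestronglyMeasurable
    (Eventually.of_forall fun x => by simpa using hd1 (u x))
  simpa [mul_assoc] using this

theorem abs_comp_le_of_deriv {G : ℝ → ℝ} (hG : ContDiff ℝ 1 G) (hG1 : ∀ t, |deriv G t| ≤ 1)
    (s t : ℝ) : |G s - G t| ≤ |s - t| := by
  have := Convex.norm_image_sub_le_of_norm_deriv_le (f := G) (C := 1) (s := univ) (x := t) (y := s)
    (fun x _ => hG.differentiable one_ne_zero x) (fun x _ => hG1 x) convex_univ (mem_univ _)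
    (mem_univ _)
  simpa using this

/-- Chain rule: `∇(G ∘ u) = G'(u) ∇u` for `G` of class `C¹` with `|G'| ≤ 1`. -/
theorem IsWeakGradient.comp_contDiff {u : E3 → ℝ} {g : E3 → E3} (hu : MemLp u 2 volume)
    (hg : MemLp g 2 volume) (hug : IsWeakGradient u g) {G : ℝ → ℝ} (hG : ContDiff ℝ 1 G)
    (hG1 : ∀ t, |deriv G t| ≤ 1) :
    IsWeakGradient (fun x => G (u x)) (fun x => deriv G (u x) • g x) := by
  obtain ⟨U, V, hU, hV, hUV, hUle, hVle, hUt, hVt⟩ := exists_smooth_approx hu hg hug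
  have hU2 : ∀ n, MemLp (U n) 2 volume := fun n =>
    memLp_two_of_lintegral_le (hU n).continuous.aestronglyMeasurable hu (hUle n)
  have hV2 : ∀ n, MemLp (V n) 2 volume := fun n =>
    memLp_two_of_lintegral_le (hV n).aestronglyMeasurable hg (hVle n)
  have hUL := tendsto_integral_norm_sub_sq hU2 hu hUle hUt
  have hVL := tendsto_integral_norm_sub_sq hV2 hg hVle hVt
  have hGc : Continuous G := hG.continuous
  have hG'c : Continuous (deriv G) := hG.continuous_deriv le_rfl
  have hGb : ∀ t, |G t| ≤ |t| + |G 0| := fun t => by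
    have h1 := abs_comp_le_of_deriv hG hG1 t 0
    have h2 := abs_sub_abs_le_abs_sub (G t) (G 0)
    rw [sub_zero] at h1
    linarith
  intro ψ hψ hc v
  have hψ'c : Continuous (fun x => fderiv ℝ ψ x v) :=
    (hψ.continuous_fderiv (by simp)).clm_apply continuous_const
  have hψ's : HasCompactSupport (fun x => fderiv ℝ ψ x v) := hc.fderiv_apply ℝ v
  have hψ2 : MemLp ψ 2 volume := hψ.continuous.memLp_of_hasCompactSupport hc
  -- the left-hand sides converge
  have hL : Tendsto (fun n => ∫ x, G (U n x) * fderiv ℝ ψ x v) atTop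
      (𝓝 (∫ x, G (u x) * fderiv ℝ ψ x v)) := by
    refine tendsto_integral_of_le_add (e := fun n x => ‖U n x - u x‖ ^ 2)
      (b := fun x => ‖fderiv ℝ ψ x v‖ ^ 2)
      (fun n => integrable_comp_mul hGc hGb (hU2 n) hψ'c hψ's)
      (integrable_comp_mul hGc hGb hu hψ'c hψ's)
      (fun n => ((hU2 n).sub hu).integrable_norm_sq) (fun n x => by positivity)
      (memLp_testDeriv hψ hc v).integrable_norm_sq (fun n => Eventually.of_forall fun x => ?_)
      hUL ?_
    · rw [← sub_mul, abs_mul]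
      have h1 := abs_comp_le_of_deriv hG hG1 (U n x) (u x)
      simp only [Real.norm_eq_abs]
      nlinarith [mul_le_mul_of_nonneg_right h1 (abs_nonneg (fderiv ℝ ψ x v)),
        sq_nonneg (|U n x - u x| - |fderiv ℝ ψ x v|), abs_nonneg (U n x - u x),
        abs_nonneg (fderiv ℝ ψ x v)]
    · filter_upwards [hUt] with x hx
      exact ((hGc.tendsto _).comp hx).mul_const _
  -- the right-hand sides converge
  have hR : Tendsto (fun n => ∫ x, deriv G (U n x) * inner ℝ (V n x) v * ψ x) atTop
      (𝓝 (∫ x, deriv G (u x) * inner ℝ (g x) v * ψ x)) := by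
    refine tendsto_integral_of_le_add (e := fun n x => ‖V n x - g x‖ ^ 2)
      (b := fun x => ‖g x‖ ^ 2 + 2 * (‖v‖ ^ 2 * ‖ψ x‖ ^ 2))
      (fun n => integrable_comp_inner_mul hG'c.measurable hG1 (hU2 n).1 (hV2 n) v hψ.continuous hc)
      (integrable_comp_inner_mul hG'c.measurable hG1 hu.1 hg v hψ.continuous hc)
      (fun n => ((hV2 n).sub hg).integrable_norm_sq) (fun n x => by positivity)
      (hg.integrable_norm_sq.add ((hψ2.integrable_norm_sq.const_mul _).const_mul 2))
      (fun n => Eventually.of_forall fun x => ?_) hVL ?_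
    · have hb : ∀ (t : ℝ) (z : E3), |deriv G t * inner ℝ z v * ψ x| ≤ ‖z‖ * (‖v‖ * ‖ψ x‖) := by
        intro t z
        rw [abs_mul, abs_mul, ← mul_assoc]
        refine mul_le_mul_of_nonneg_right ?_ (abs_nonneg _)
        calc |deriv G t| * |inner ℝ z v| ≤ 1 * (‖z‖ * ‖v‖) :=
              mul_le_mul (hG1 t) (abs_real_inner_le_norm z v) (abs_nonneg _) zero_le_one
          _ = _ := one_mul _
      have h1 := hb (U n x) (V n x)
      have h2 := hb (u x) (g x)
      have h3 : ‖V n x‖ ≤ ‖V n x - g x‖ + ‖g x‖ := by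
        simpa using norm_add_le (V n x - g x) (g x)
      have h4 := abs_sub (deriv G (U n x) * inner ℝ (V n x) v * ψ x)
        (deriv G (u x) * inner ℝ (g x) v * ψ x)
      have h5 : 0 ≤ ‖v‖ * ‖ψ x‖ := by positivity
      rw [← mul_pow]
      nlinarith [mul_le_mul_of_nonneg_right h3 h5, sq_nonneg (‖V n x - g x‖ - ‖v‖ * ‖ψ x‖),
        sq_nonneg (‖g x‖ - ‖v‖ * ‖ψ x‖), sq_nonneg ‖V n x - g x‖]
    · filter_upwards [hUt, hVt] with x hx hx'
      exact ((((hG'c.tendsto _).comp hx).mul (hx'.inner tendsto_const_nhds))).mul_const _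
  -- integration by parts for the smooth approximations
  have hibp : ∀ n, ∫ x, G (U n x) * fderiv ℝ ψ x v =
      - ∫ x, deriv G (U n x) * inner ℝ (V n x) v * ψ x := by
    intro n
    have hfd : ∀ x, fderiv ℝ (fun x => G (U n x)) x v = deriv G (U n x) * inner ℝ (V n x) v := by
      intro x
      have h := (hG.differentiable one_ne_zero (U n x)).hasDerivAt.comp_hasFDerivAt x
        ((hU n).differentiable (by simp) x).hasFDerivAt
      rw [show fderiv ℝ (fun x => G (U n x)) x = _ from h.fderiv]
      simp [hUV]
    have := integral_mul_fderiv_eq_neg_fderiv_mul_of_integrable (μ := (volume : Measure E3))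
      (f := fun x => G (U n x)) (g := ψ) (v := v) ?_ ?_ ?_ ?_ ?_
    · rw [this]
      simp only [hfd]
    · simp only [hfd]
      exact integrable_comp_inner_mul hG'c.measurable hG1 (hU2 n).1 (hV2 n) v hψ.continuous hc
    · exact integrable_comp_mul hGc hGb (hU2 n) hψ'c hψ's
    · exact integrable_comp_mul hGc hGb (hU2 n) hψ.continuous hc
    · exact fun x _ => (hG.differentiable one_ne_zero _).comp x ((hU n).differentiable (by simp) x)
    · exact fun x _ => hψ.differentiable (by simp) x
  simp only [real_inner_smul_left]
  exact tendsto_nhds_unique hL ((hR.neg).congr fun n => (hibp n).symm)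

/-- Chain rule for a pointwise limit `G` of `C¹` functions `Gₖ` with `|Gₖ'| ≤ 1` whose derivatives
converge pointwise to `d`: one has `∇(G ∘ u) = d(u) ∇u`. -/
theorem IsWeakGradient.comp_of_tendsto {u : E3 → ℝ} {g : E3 → E3} (hu : MemLp u 2 volume)
    (hg : MemLp g 2 volume) (hug : IsWeakGradient u g) {Gk : ℕ → ℝ → ℝ} {G d : ℝ → ℝ}
    (hG : ∀ k, ContDiff ℝ 1 (Gk k)) (hG1 : ∀ k t, |deriv (Gk k) t| ≤ 1) {C : ℝ}
    (hGb : ∀ k t, |Gk k t| ≤ |t| + C) (hGt : ∀ t, Tendsto (fun k => Gk k t) atTop (𝓝 (G t)))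
    (hdt : ∀ t, Tendsto (fun k => deriv (Gk k) t) atTop (𝓝 (d t))) :
    IsWeakGradient (fun x => G (u x)) (fun x => d (u x) • g x) := by
  intro ψ hψ hc v
  have hψ'c : Continuous (fun x => fderiv ℝ ψ x v) :=
    (hψ.continuous_fderiv (by simp)).clm_apply continuous_const
  have hψ's : HasCompactSupport (fun x => fderiv ℝ ψ x v) := hc.fderiv_apply ℝ v
  have hL : Tendsto (fun k => ∫ x, Gk k (u x) * fderiv ℝ ψ x v) atTop
      (𝓝 (∫ x, G (u x) * fderiv ℝ ψ x v)) := by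
    refine tendsto_integral_of_dominated_convergence (fun x => |(|u x| + C) * fderiv ℝ ψ x v|)
      (fun k => (integrable_comp_mul (hG k).continuous (hGb k) hu hψ'c hψ's).1) ?_
      (fun k => Eventually.of_forall fun x => ?_)
      (Eventually.of_forall fun x => (hGt _).mul_const _)
    · exact (integrable_comp_mul (G := fun t => |t| + C) (by fun_prop) (C := |C|)
        (fun t => (abs_add_le _ _).trans (by simp)) hu hψ'c hψ's).abs
    · rw [norm_mul, abs_mul, Real.norm_eq_abs, Real.norm_eq_abs]
      exact mul_le_mul_of_nonneg_right ((hGb k _).trans (le_abs_self _)) (abs_nonneg _)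
  have hR : Tendsto (fun k => ∫ x, deriv (Gk k) (u x) * inner ℝ (g x) v * ψ x) atTop
      (𝓝 (∫ x, d (u x) * inner ℝ (g x) v * ψ x)) := by
    refine tendsto_integral_of_dominated_convergence (fun x => |inner ℝ (g x) v * ψ x|)
      (fun k => (integrable_comp_inner_mul ((hG k).continuous_deriv le_rfl).measurable (hG1 k)
        hu.1 hg v hψ.continuous hc).1) ?_ (fun k => Eventually.of_forall fun x => ?_)
      (Eventually.of_forall fun x => ((hdt _).mul_const _).mul_const _)
    · have : Integrable (fun x => inner ℝ (g x) v * ψ x) :=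
        MemLp.integrable_mul (p := 2) (q := 2) (hg.inner_const v)
          (hψ.continuous.memLp_of_hasCompactSupport hc)
      exact this.abs
    · rw [mul_assoc, norm_mul, Real.norm_eq_abs, Real.norm_eq_abs]
      exact mul_le_of_le_one_left (abs_nonneg _) (hG1 k _)
  simp only [real_inner_smul_left]
  refine tendsto_nhds_unique hL ((hR.neg).congr fun k => ?_)
  have := (hug.comp_contDiff hu hg (hG k) (hG1 k)) ψ hψ hc v
  simp only [real_inner_smul_left] at this
  exact this.symm

/-- `∇|u| = (u / |u|) ∇u`, obtained from the approximations `√(t² + ε²)` of `|t|`. -/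
theorem IsWeakGradient.abs {u : E3 → ℝ} {g : E3 → E3} (hu : MemLp u 2 volume)
    (hg : MemLp g 2 volume) (hug : IsWeakGradient u g) :
    IsWeakGradient (fun x => |u x|) (fun x => (u x / |u x|) • g x) := by
  let ε : ℕ → ℝ := fun k => 1 / ((k : ℝ) + 1)
  have hε0 : ∀ k, 0 < ε k := fun k => by positivity
  have hε1 : ∀ k, ε k ≤ 1 := fun k => by
    rw [div_le_one (by positivity)]
    have : (0 : ℝ) ≤ k := k.cast_nonneg
    linarith
  have hε : Tendsto ε atTop (𝓝 0) := tendsto_one_div_add_atTop_nhds_zero_nat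
  have hpos : ∀ k t, 0 < t ^ 2 + ε k ^ 2 := fun k t => by have := hε0 k; positivity
  have hder : ∀ k t, deriv (fun t => √(t ^ 2 + ε k ^ 2)) t = t / √(t ^ 2 + ε k ^ 2) := by
    intro k t
    have h : HasDerivAt (fun t : ℝ => t ^ 2 + ε k ^ 2) (2 * t) t := by
      simpa using (hasDerivAt_pow 2 t).add_const (ε k ^ 2)
    rw [(h.sqrt (hpos k t).ne').deriv]
    field_simp
  have hlim : ∀ t, Tendsto (fun k => √(t ^ 2 + ε k ^ 2)) atTop (𝓝 |t|) := fun t => by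
    have : Tendsto (fun k => t ^ 2 + ε k ^ 2) atTop (𝓝 (t ^ 2 + 0 ^ 2)) :=
      (hε.pow 2).const_add _
    simpa [Real.sqrt_sq_eq_abs] using this.sqrt
  refine hug.comp_of_tendsto hu hg (Gk := fun k t => √(t ^ 2 + ε k ^ 2)) (G := fun t => |t|)
    (d := fun t => t / |t|) (C := 1)
    (fun k => ContDiff.sqrt (by fun_prop) fun t => (hpos k t).ne') (fun k t => ?_)
    (fun k t => ?_) hlim fun t => ?_
  · rw [hder, abs_div, abs_of_pos (Real.sqrt_pos.2 (hpos k t))]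
    refine div_le_one_of_le₀ ?_ (Real.sqrt_nonneg _)
    exact Real.abs_le_sqrt (by nlinarith [sq_nonneg (ε k)])
  · rw [abs_of_nonneg (Real.sqrt_nonneg _)]
    refine Real.sqrt_le_iff.2 ⟨by positivity, ?_⟩
    nlinarith [sq_abs t, abs_nonneg t, hε0 k, hε1 k]
  · simp only [hder]
    rcases eq_or_ne t 0 with rfl | ht
    · simp
    · exact tendsto_const_nhds.div (hlim t) (abs_ne_zero.2 ht)

theorem IsWeakGradient.ae_eq {u : E3 → ℝ} {g₁ g₂ : E3 → E3} (h₁ : IsWeakGradient u g₁)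
    (h₂ : IsWeakGradient u g₂) (hg₁ : MemLp g₁ 2 volume) (hg₂ : MemLp g₂ 2 volume) :
    ∀ᵐ x, g₁ x = g₂ x := by
  refine ae_eq_of_integral_contDiff_smul_eq (hg₁.locallyIntegrable (by norm_num))
    (hg₂.locallyIntegrable (by norm_num)) fun ψ hψ hc => ?_
  have hint : ∀ {g : E3 → E3}, MemLp g 2 volume → Integrable (fun x => ψ x • g x) := fun hg =>
    (hg.locallyIntegrable (by norm_num)).integrable_smul_left_of_hasCompactSupport
      hψ.continuous hc
  refine ext_inner_left ℝ fun v => ?_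
  rw [← integral_inner (hint hg₁), ← integral_inner (hint hg₂)]
  have := (h₁ ψ hψ hc v).symm.trans (h₂ ψ hψ hc v)
  rw [neg_inj] at this
  simpa only [real_inner_smul_right, real_inner_comm v, mul_comm] using this

/-- The weak gradient vanishes almost everywhere on the zero set: the functions
`arctan (k t) / k` tend to `0`, their derivatives to the indicator of `{0}`. -/
theorem IsWeakGradient.eq_zero_of_eq_zero {u : E3 → ℝ} {g : E3 → E3} (hu : MemLp u 2 volume)
    (hg : MemLp g 2 volume) (hug : IsWeakGradient u g) : ∀ᵐ x, u x = 0 → g x = 0 := by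
  let a : ℕ → ℝ := fun k => (k : ℝ) + 1
  have ha0 : ∀ k, 0 < a k := fun k => by positivity
  have ha : Tendsto a atTop atTop := tendsto_natCast_atTop_atTop.atTop_add tendsto_const_nhds
  let Gk : ℕ → ℝ → ℝ := fun k t => Real.arctan (a k * t) / a k
  let d : ℝ → ℝ := fun t => if t = 0 then 1 else 0
  have hder : ∀ k t, deriv (Gk k) t = 1 / (1 + (a k * t) ^ 2) := by
    intro k t
    have h : HasDerivAt (fun t : ℝ => a k * t) (a k) t := by
      simpa using (hasDerivAt_id t).const_mul (a k)
    rw [(h.arctan.div_const (a k)).deriv]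
    have := (ha0 k).ne'
    field_simp
  have hdm : Measurable d := Measurable.ite (measurableSet_singleton 0) measurable_const
    measurable_const
  have hzero : IsWeakGradient (fun _ => 0) (fun x => d (u x) • g x) := by
    refine hug.comp_of_tendsto hu hg (Gk := Gk) (G := fun _ => 0) (d := d) (C := 2)
      (fun k => ?_) (fun k t => ?_) (fun k t => ?_) (fun t => ?_) fun t => ?_
    · exact (Real.contDiff_arctan.comp (contDiff_const.mul contDiff_id)).div_const _
    · rw [hder, abs_of_pos (by positivity)]
      exact div_le_one_of_le₀ (by nlinarith [sq_nonneg (a k * t)]) (by positivity)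
    · have h1 : |Real.arctan (a k * t)| ≤ 2 := by
        rw [abs_le]
        constructor <;> linarith [Real.neg_pi_div_two_lt_arctan (a k * t),
          Real.arctan_lt_pi_div_two (a k * t), Real.pi_le_four]
      have h2 : 1 ≤ a k := le_add_of_nonneg_left k.cast_nonneg
      rw [abs_div, abs_of_pos (ha0 k)]
      exact (div_le_self (abs_nonneg _) h2).trans (h1.trans (by simp))
    · refine squeeze_zero_norm (a := fun k => 2 / a k) (fun k => ?_) (ha.const_div_atTop 2)
      rw [norm_div, Real.norm_of_nonneg (ha0 k).le]
      refine div_le_div_of_nonneg_right ?_ (ha0 k).le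
      rw [Real.norm_eq_abs, abs_le]
      constructor <;> linarith [Real.neg_pi_div_two_lt_arctan (a k * t),
        Real.arctan_lt_pi_div_two (a k * t), Real.pi_le_four]
    · simp only [hder, d]
      rcases eq_or_ne t 0 with rfl | ht
      · simp
      · rw [if_neg ht]
        refine Tendsto.const_div_atTop ?_ 1
        refine tendsto_atTop_add_const_left _ _ ?_
        simp only [mul_pow]
        exact ((tendsto_pow_atTop two_ne_zero).comp ha).atTop_mul_const (by positivity)
  have hzero' : IsWeakGradient (fun _ => 0) (fun _ => (0 : E3)) := fun ψ _ _ v => by simp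
  have hdg : MemLp (fun x => d (u x) • g x) 2 volume := by
    refine hg.mono ((hdm.comp_aemeasurable hu.1.aemeasurable).aestronglyMeasurable.smul hg.1)
      (Eventually.of_forall fun x => ?_)
    rw [norm_smul]
    refine mul_le_of_le_one_left (norm_nonneg _) ?_
    simp only [d]
    split_ifs <;> simp
  filter_upwards [hzero.ae_eq hzero' hdg MemLp.zero] with x hx h0
  simpa [d, h0] using hx

/-! ### The space of radial functions -/

namespace H1rad

theorem memLp_fn (u : H1rad) : MemLp u.fn 2 volume := Lp.memLp u.1.fst

theorem memLp_grad (u : H1rad) : MemLp u.grad 2 volume := Lp.memLp u.1.snd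

theorem isWeakGradient (u : H1rad) : IsWeakGradient u.fn u.grad := u.2.1

theorem exists_radial (u : H1rad) : ∃ h : ℝ → ℝ, ∀ᵐ x : E3, u.fn x = h ‖x‖ := u.2.2

theorem aesm_fn (u : H1rad) : AEStronglyMeasurable u.fn volume := u.memLp_fn.1

theorem aesm_grad (u : H1rad) : AEStronglyMeasurable u.grad volume := u.memLp_grad.1

theorem fn_add (u v : H1rad) : (u + v).fn =ᵐ[volume] u.fn + v.fn := Lp.coeFn_add u.1.fst v.1.fst

theorem fn_sub (u v : H1rad) : (u - v).fn =ᵐ[volume] u.fn - v.fn := Lp.coeFn_sub u.1.fst v.1.fst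

theorem fn_neg (u : H1rad) : (-u).fn =ᵐ[volume] -u.fn := Lp.coeFn_neg u.1.fst

theorem fn_smul (t : ℝ) (u : H1rad) : (t • u).fn =ᵐ[volume] t • u.fn := Lp.coeFn_smul t u.1.fst

theorem grad_sub (u v : H1rad) : (u - v).grad =ᵐ[volume] u.grad - v.grad :=
  Lp.coeFn_sub u.1.snd v.1.snd

theorem integrable_norm_sq (u : H1rad) :
    Integrable (fun x => ‖u.grad x‖ ^ 2 + u.fn x ^ 2) volume := by
  have h : Integrable (fun x => u.fn x ^ 2) volume := by
    simpa using u.memLp_fn.integrable_norm_sq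
  exact u.memLp_grad.integrable_norm_sq.add h

theorem norm_sq_eq (u : H1rad) : ‖u‖ ^ 2 = ∫ x, (‖u.grad x‖ ^ 2 + u.fn x ^ 2) := by
  have h : ‖u‖ ^ 2 = ‖u.1.fst‖ ^ 2 + ‖u.1.snd‖ ^ 2 := WithLp.prod_norm_sq_eq_of_L2 u.1
  have e : ∀ {F : Type} [NormedAddCommGroup F] [InnerProductSpace ℝ F]
      (w : Lp F 2 (volume : Measure E3)), ‖w‖ ^ 2 = ∫ x, ‖w x‖ ^ 2 := fun w => by
    rw [← real_inner_self_eq_norm_sq, L2.inner_def]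
    simp
  rw [h, e, e, integral_add u.memLp_grad.integrable_norm_sq
    (by simpa using u.memLp_fn.integrable_norm_sq), add_comm]
  simp only [Real.norm_eq_abs, sq_abs]
  rfl

theorem ext_fn {u v : H1rad} (h : u.fn =ᵐ[volume] v.fn) : u = v := by
  have h1 : u.1.fst = v.1.fst := Lp.ext h
  have hu := u.isWeakGradient
  have h2 : u.1.snd = v.1.snd := by
    refine Lp.ext (IsWeakGradient.ae_eq hu (fun ψ hψ hc w => ?_) u.memLp_grad v.memLp_grad)
    rw [show u.fn = v.fn from congrArg (fun z : Lp ℝ 2 (volume : Measure E3) => (z : E3 → ℝ)) h1]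
    exact v.isWeakGradient ψ hψ hc w
  exact Subtype.ext (WithLp.ofLp_injective 2 (Prod.ext h1 h2))

/-- The element of `H¹_rad` with given function and weak gradient. -/
theorem exists_of_isWeakGradient {u : E3 → ℝ} {g : E3 → E3} (hu : MemLp u 2 volume)
    (hg : MemLp g 2 volume) (hug : IsWeakGradient u g)
    (hr : ∃ h : ℝ → ℝ, ∀ᵐ x : E3, u x = h ‖x‖) :
    ∃ w : H1rad, w.fn =ᵐ[volume] u ∧ w.grad =ᵐ[volume] g := by
  let z : L2Pair := WithLp.toLp 2 (hu.toLp u, hg.toLp g)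
  have h1 : z.fst =ᵐ[volume] u := hu.coeFn_toLp
  have h2 : z.snd =ᵐ[volume] g := hg.coeFn_toLp
  refine ⟨⟨z, fun ψ hψ hc v => ?_, ?_⟩, h1, h2⟩
  · rw [integral_congr_ae (h1.mono fun x hx => congrArg (· * fderiv ℝ ψ x v) hx),
      integral_congr_ae (h2.mono fun x hx => congrArg (fun y => inner ℝ y v * ψ x) hx)]
    exact hug ψ hψ hc v
  · obtain ⟨h, hh⟩ := hr
    exact ⟨h, h1.trans hh⟩

theorem integral_fn_sq_le (u : H1rad) : ∫ x, u.fn x ^ 2 ≤ ‖u‖ ^ 2 := by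
  rw [norm_sq_eq]
  refine integral_mono (by simpa using u.memLp_fn.integrable_norm_sq) u.integrable_norm_sq
    fun x => ?_
  simp only [le_add_iff_nonneg_left]
  positivity

theorem eLpNorm_add_le_norm (u : H1rad) :
    eLpNorm u.fn 2 volume + eLpNorm u.grad 2 volume ≤ ENNReal.ofReal (2 * ‖u‖) := by
  have h : ‖u‖ ^ 2 = ‖u.1.fst‖ ^ 2 + ‖u.1.snd‖ ^ 2 := WithLp.prod_norm_sq_eq_of_L2 u.1
  have h1 : ‖u.1.fst‖ ≤ ‖u‖ := abs_le_of_sq_le_sq' (by nlinarith) (norm_nonneg _) |>.2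
  have h2 : ‖u.1.snd‖ ≤ ‖u‖ := abs_le_of_sq_le_sq' (by nlinarith) (norm_nonneg _) |>.2
  rw [two_mul, ENNReal.ofReal_add (norm_nonneg _) (norm_nonneg _)]
  have e1 : eLpNorm u.fn 2 volume = ENNReal.ofReal ‖u.1.fst‖ := by
    rw [Lp.norm_def, ENNReal.ofReal_toReal (Lp.eLpNorm_ne_top _)]
    rfl
  have e2 : eLpNorm u.grad 2 volume = ENNReal.ofReal ‖u.1.snd‖ := by
    rw [Lp.norm_def, ENNReal.ofReal_toReal (Lp.eLpNorm_ne_top _)]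
    rfl
  rw [e1, e2]
  gcongr

theorem exists_lintegral_four_bound :
    ∃ K : ℝ, 0 ≤ K ∧ ∀ u : H1rad, ∫⁻ x, ‖u.fn x‖ₑ ^ 4 ≤ ENNReal.ofReal (K * ‖u‖ ^ 4) := by
  obtain ⟨K, hK⟩ := exists_lintegral_four_le
  refine ⟨K * 2 ^ 4, by positivity, fun u => ?_⟩
  refine (hK _ _ u.memLp_fn u.memLp_grad u.isWeakGradient).trans ?_
  calc (K : ENNReal) * (eLpNorm u.fn 2 volume + eLpNorm u.grad 2 volume) ^ 4
      ≤ K * ENNReal.ofReal (2 * ‖u‖) ^ 4 := by gcongr; exact u.eLpNorm_add_le_norm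
    _ = ENNReal.ofReal (K * 2 ^ 4 * ‖u‖ ^ 4) := by
      rw [← ENNReal.ofReal_pow (by positivity), ← ENNReal.ofReal_coe_nnreal,
        ← ENNReal.ofReal_mul (by positivity), mul_pow, mul_assoc]

theorem memLp_fn_four (u : H1rad) : MemLp u.fn 4 volume := by
  obtain ⟨K, -, hK⟩ := exists_lintegral_four_bound
  refine ⟨u.aesm_fn, ?_⟩
  have h := (hK u).trans_lt ENNReal.ofReal_lt_top
  rw [← eLpNorm_natCast_pow u.fn four_ne_zero] at h
  exact (ENNReal.pow_lt_top_iff).1 h |>.resolve_right (by norm_num)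

theorem integrable_fn_sq (u : H1rad) : Integrable (fun x => u.fn x ^ 2) volume := by
  simpa using u.memLp_fn.integrable_norm_sq

theorem integrable_fn_four (u : H1rad) : Integrable (fun x => u.fn x ^ 4) volume := by
  have := u.memLp_fn_four.integrable_norm_pow (p := 4) four_ne_zero
  refine this.congr (Eventually.of_forall fun x => ?_)
  simp only [Real.norm_eq_abs]
  exact Even.pow_abs (by decide) _

theorem exists_integral_four_bound :
    ∃ K : ℝ, 0 ≤ K ∧ ∀ u : H1rad, ∫ x, u.fn x ^ 4 ≤ K * ‖u‖ ^ 4 := by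
  obtain ⟨K, hK0, hK⟩ := exists_lintegral_four_bound
  refine ⟨K, hK0, fun u => ?_⟩
  rw [integral_eq_lintegral_of_nonneg_ae (Eventually.of_forall fun x => by positivity)
    u.integrable_fn_four.1]
  refine ENNReal.toReal_le_of_le_ofReal (by positivity) ((hK u).trans' (le_of_eq ?_))
  refine lintegral_congr fun x => ?_
  rw [Real.enorm_eq_ofReal_abs, ← ENNReal.ofReal_pow (abs_nonneg _), Even.pow_abs (by decide)]

/-- A convergent sequence has a subsequence converging almost everywhere. -/
theorem exists_subseq_ae {w : ℕ → H1rad} {u : H1rad} (h : Tendsto w atTop (𝓝 u)) :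
    ∃ ns : ℕ → ℕ, StrictMono ns ∧
      ∀ᵐ x, Tendsto (fun k => (w (ns k)).fn x) atTop (𝓝 (u.fn x)) := by
  have h1 : Tendsto (fun n => (w n).1.fst) atTop (𝓝 u.1.fst) := by
    have hc : Continuous (fun z : H1rad => z.1.fst) :=
      (WithLp.fstL 2 ℝ (Lp ℝ 2 (volume : Measure E3)) (Lp E3 2 (volume : Measure E3))).continuous.comp
        continuous_subtype_val
    exact (hc.tendsto u).comp h
  exact (tendstoInMeasure_of_tendsto_Lp h1).exists_seq_tendsto_ae

/-- A map into a topological space is continuous at `u` if every sequence converging to `u` both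
in `H¹` and almost everywhere has a subsequence along which it converges. -/
theorem continuous_of_seq {Y : Type*} [TopologicalSpace Y] {Φ : H1rad → Y}
    (h : ∀ (w : ℕ → H1rad) (u : H1rad), Tendsto w atTop (𝓝 u) →
      (∀ᵐ x, Tendsto (fun k => (w k).fn x) atTop (𝓝 (u.fn x))) →
      Tendsto (fun k => Φ (w k)) atTop (𝓝 (Φ u))) : Continuous Φ := by
  refine continuous_iff_continuousAt.2 fun u => ?_
  refine tendsto_of_seq_tendsto fun w hw => ?_
  refine tendsto_of_subseq_tendsto fun ns hns => ?_
  obtain ⟨ms, hms, hae⟩ := exists_subseq_ae (hw.comp hns)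
  exact ⟨ms, h _ u ((hw.comp hns).comp hms.tendsto_atTop) hae⟩

/-! ### Truncation -/

theorem exists_abs (u : H1rad) : ∃ w : H1rad, w.fn =ᵐ[volume] (fun x => |u.fn x|) ∧
    w.grad =ᵐ[volume] fun x => (u.fn x / |u.fn x|) • u.grad x := by
  refine exists_of_isWeakGradient u.memLp_fn.abs ?_
    (u.isWeakGradient.abs u.memLp_fn u.memLp_grad) ?_
  · have hm : AEStronglyMeasurable (fun x => u.fn x / |u.fn x|) volume :=
      (u.aesm_fn.aemeasurable.div u.aesm_fn.norm.aemeasurable).aestronglyMeasurable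
    refine u.memLp_grad.mono (hm.smul u.aesm_grad) (Eventually.of_forall fun x => ?_)
    rw [norm_smul]
    refine mul_le_of_le_one_left (norm_nonneg _) ?_
    rw [norm_div, Real.norm_eq_abs, Real.norm_eq_abs, abs_abs]
    exact div_self_le_one _
  · obtain ⟨h, hh⟩ := u.exists_radial
    exact ⟨fun r => |h r|, hh.mono fun x hx => by rw [hx]⟩

/-- The absolute value `|u|` as an element of `H¹_rad`. -/
noncomputable def abs (u : H1rad) : H1rad := u.exists_abs.choose

theorem fn_abs (u : H1rad) : u.abs.fn =ᵐ[volume] fun x => |u.fn x| := u.exists_abs.choose_spec.1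

theorem grad_abs (u : H1rad) : u.abs.grad =ᵐ[volume] fun x => (u.fn x / |u.fn x|) • u.grad x :=
  u.exists_abs.choose_spec.2

theorem norm_abs (u : H1rad) : ‖u.abs‖ = ‖u‖ := by
  rw [← sq_eq_sq₀ (norm_nonneg _) (norm_nonneg _), norm_sq_eq, norm_sq_eq]
  refine integral_congr_ae ?_
  filter_upwards [u.fn_abs, u.grad_abs,
    u.isWeakGradient.eq_zero_of_eq_zero u.memLp_fn u.memLp_grad] with x h1 h2 h3
  rw [h1, h2, sq_abs, norm_smul]
  rcases eq_or_ne (u.fn x) 0 with h0 | h0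
  · simp [h3 h0]
  · rw [norm_div, Real.norm_eq_abs, Real.norm_eq_abs, abs_abs, div_self (abs_ne_zero.2 h0), one_mul]

theorem tendsto_iff_integral {w : ℕ → H1rad} {u : H1rad} :
    Tendsto w atTop (𝓝 u) ↔
      Tendsto (fun n => ∫ x, (‖(w n).grad x - u.grad x‖ ^ 2 + ((w n).fn x - u.fn x) ^ 2))
        atTop (𝓝 0) := by
  have e : ∀ n, ∫ x, (‖(w n).grad x - u.grad x‖ ^ 2 + ((w n).fn x - u.fn x) ^ 2) =
      ‖w n - u‖ ^ 2 := fun n => by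
    rw [norm_sq_eq]
    refine integral_congr_ae ?_
    filter_upwards [fn_sub (w n) u, grad_sub (w n) u] with x h1 h2
    rw [h1, h2]
    rfl
  simp_rw [e]
  rw [tendsto_iff_norm_sub_tendsto_zero]
  refine ⟨fun h => by simpa using h.pow 2, fun h => ?_⟩
  have := h.sqrt
  simpa [Real.sqrt_sq (norm_nonneg _)] using this

/-- The map `u ↦ |u|` is continuous on `H¹_rad`; on `{u = 0}`, where the sign is discontinuous,
the gradient of the limit vanishes. -/
theorem continuous_abs : Continuous (abs : H1rad → H1rad) := by
  refine continuous_of_seq fun w u hw hae => ?_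
  rw [tendsto_iff_integral] at hw ⊢
  let S : H1rad → E3 → ℝ := fun v x => v.fn x / |v.fn x|
  have hS1 : ∀ v x, |S v x| ≤ 1 := fun v x => by
    rw [abs_div, abs_abs]
    exact div_self_le_one _
  have hSm : ∀ v, AEStronglyMeasurable (S v) volume := fun v =>
    (v.aesm_fn.aemeasurable.div v.aesm_fn.norm.aemeasurable).aestronglyMeasurable
  have hres : Tendsto (fun n => ∫ x, 2 * (|S (w n) x - S u x| ^ 2 * ‖u.grad x‖ ^ 2)) atTop (𝓝 0) := by
    have := tendsto_integral_of_dominated_convergence (f := fun _ => (0 : ℝ))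
      (F := fun n x => 2 * (|S (w n) x - S u x| ^ 2 * ‖u.grad x‖ ^ 2))
      (fun x => 2 * (4 * ‖u.grad x‖ ^ 2)) (fun n => ?_)
      ((u.memLp_grad.integrable_norm_sq.const_mul 4).const_mul 2)
      (fun n => Eventually.of_forall fun x => ?_) ?_
    · simpa using this
    · exact (((((hSm _).sub (hSm _)).norm).pow 2).mul (u.aesm_grad.norm.pow 2)).const_mul 2
    · rw [Real.norm_of_nonneg (by positivity)]
      have h1 : |S (w n) x - S u x| ≤ 2 := by
        have := abs_sub (S (w n) x) (S u x)
        linarith [hS1 (w n) x, hS1 u x]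
      gcongr
      nlinarith [abs_nonneg (S (w n) x - S u x)]
    · filter_upwards [hae, u.isWeakGradient.eq_zero_of_eq_zero u.memLp_fn u.memLp_grad]
        with x hx h0
      rcases eq_or_ne (u.fn x) 0 with hz | hz
      · simp [h0 hz]
      · have h1 : Tendsto (fun n => S (w n) x) atTop (𝓝 (S u x)) :=
          hx.div hx.abs (abs_ne_zero.2 hz)
        have h2 := ((((h1.sub_const (S u x)).abs.pow 2).mul_const (‖u.grad x‖ ^ 2)).const_mul 2)
        simpa using h2
  have hdint : ∀ n, Integrable
      (fun x => ‖(w n).grad x - u.grad x‖ ^ 2 + ((w n).fn x - u.fn x) ^ 2) volume := fun n => by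
    have h1 : Integrable (fun x => ‖(w n).grad x - u.grad x‖ ^ 2) volume :=
      ((w n).memLp_grad.sub u.memLp_grad).integrable_norm_sq
    have h2 : Integrable (fun x => ((w n).fn x - u.fn x) ^ 2) volume := by
      simpa using ((w n).memLp_fn.sub u.memLp_fn).integrable_norm_sq
    exact h1.add h2
  have hrint : ∀ n, Integrable (fun x => 2 * (|S (w n) x - S u x| ^ 2 * ‖u.grad x‖ ^ 2)) volume := by
    intro n
    refine ((u.memLp_grad.integrable_norm_sq.const_mul 4).const_mul 2).mono'
      ((((((hSm _).sub (hSm _)).norm).pow 2).mul (u.aesm_grad.norm.pow 2)).const_mul 2)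
      (Eventually.of_forall fun x => ?_)
    rw [Real.norm_of_nonneg (by positivity)]
    have h1 : |S (w n) x - S u x| ≤ 2 := by
      have := abs_sub (S (w n) x) (S u x)
      linarith [hS1 (w n) x, hS1 u x]
    gcongr
    nlinarith [abs_nonneg (S (w n) x - S u x)]
  refine squeeze_zero (fun n => integral_nonneg fun x => by positivity) (fun n => ?_)
    (by simpa only [mul_zero, add_zero] using (hw.const_mul 2).add hres)
  rw [← integral_const_mul, ← integral_add ((hdint n).const_mul 2) (hrint n)]
  have hl : Integrable (fun x => ‖(w n).abs.grad x - u.abs.grad x‖ ^ 2 +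
      ((w n).abs.fn x - u.abs.fn x) ^ 2) volume := by
    have h1 : Integrable (fun x => ‖(w n).abs.grad x - u.abs.grad x‖ ^ 2) volume :=
      ((w n).abs.memLp_grad.sub u.abs.memLp_grad).integrable_norm_sq
    have h2 : Integrable (fun x => ((w n).abs.fn x - u.abs.fn x) ^ 2) volume := by
      simpa using ((w n).abs.memLp_fn.sub u.abs.memLp_fn).integrable_norm_sq
    exact h1.add h2
  refine integral_mono_ae hl (((hdint n).const_mul 2).add (hrint n)) ?_
  filter_upwards [(w n).fn_abs, u.fn_abs, (w n).grad_abs, u.grad_abs] with x h1 h2 h3 h4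
  rw [h1, h2, h3, h4]
  have e : (w n).fn x / |(w n).fn x| = S (w n) x := rfl
  have e' : u.fn x / |u.fn x| = S u x := rfl
  rw [e, e']
  have k1 : (|(w n).fn x| - |u.fn x|) ^ 2 ≤ ((w n).fn x - u.fn x) ^ 2 :=
    sq_le_sq.2 (abs_abs_sub_abs_le_abs_sub _ _)
  have k2 : ‖S (w n) x • (w n).grad x - S u x • u.grad x‖ ≤
      ‖(w n).grad x - u.grad x‖ + |S (w n) x - S u x| * ‖u.grad x‖ := by
    have : S (w n) x • (w n).grad x - S u x • u.grad x =
        S (w n) x • ((w n).grad x - u.grad x) + (S (w n) x - S u x) • u.grad x := by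
      rw [smul_sub, sub_smul]; abel
    rw [this]
    refine (norm_add_le _ _).trans ?_
    rw [norm_smul, norm_smul, Real.norm_eq_abs, Real.norm_eq_abs]
    gcongr
    exact mul_le_of_le_one_left (norm_nonneg _) (hS1 _ _)
  have k3 := pow_le_pow_left₀ (norm_nonneg _) k2 2
  rw [← mul_pow]
  nlinarith [sq_nonneg (‖(w n).grad x - u.grad x‖ - |S (w n) x - S u x| * ‖u.grad x‖),
    sq_nonneg ((w n).fn x - u.fn x)]

/-- The positive part `u⁺` as an element of `H¹_rad`. -/
noncomputable def pos (u : H1rad) : H1rad := (1 / 2 : ℝ) • (u + u.abs)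

theorem fn_pos (u : H1rad) : u.pos.fn =ᵐ[volume] fun x => max (u.fn x) 0 := by
  filter_upwards [fn_smul (1 / 2 : ℝ) (u + u.abs), fn_add u u.abs, u.fn_abs] with x h1 h2 h3
  rw [pos, h1, Pi.smul_apply, h2, Pi.add_apply, h3, smul_eq_mul]
  rcases le_total (u.fn x) 0 with h | h
  · rw [max_eq_right h, abs_of_nonpos h]; ring
  · rw [max_eq_left h, abs_of_nonneg h]; ring

theorem continuous_pos : Continuous (pos : H1rad → H1rad) :=
  (continuous_id.add continuous_abs).const_smul (1 / 2 : ℝ)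

theorem abs_neg (u : H1rad) : (-u).abs = u.abs := by
  refine ext_fn ?_
  filter_upwards [(-u).fn_abs, u.fn_abs, fn_neg u] with x h1 h2 h3
  rw [h1, h2, h3, Pi.neg_apply, _root_.abs_neg]

theorem pos_sub_pos_neg (u : H1rad) : u.pos - (-u).pos = u := by
  rw [pos, pos, abs_neg, ← smul_sub]
  have : u + u.abs - (-u + u.abs) = (2 : ℝ) • u := by rw [two_smul]; abel
  rw [this, smul_smul]
  norm_num

/-- Orthogonality of `u⁺` and `u⁻` in `H¹`: `4⟨u⁺, (-u)⁺⟩ = ‖|u|‖² - ‖u‖²`. -/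
theorem inner_pos_pos_neg (u : H1rad) : inner ℝ u.pos (-u).pos = 0 := by
  have e : ∀ a b : H1rad, inner ℝ ((1 / 2 : ℝ) • a) ((1 / 2 : ℝ) • b) = 1 / 4 * inner ℝ a b :=
    fun a b => (real_inner_smul_left a _ _).trans (by
      rw [show inner ℝ a ((1 / 2 : ℝ) • b) = _ from real_inner_smul_right a b _]; ring)
  rw [pos, pos, abs_neg, e]
  have : inner ℝ (u + u.abs) (-u + u.abs) = 0 := by
    rw [inner_add_left, inner_add_right, inner_add_right, inner_neg_right, inner_neg_right,
      real_inner_self_eq_norm_sq, real_inner_self_eq_norm_sq, norm_abs, real_inner_comm u.abs u]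
    ring
  rw [this, mul_zero]

theorem eq_pos_of_isPosPart {u p : H1rad} (h : IsPosPart u p) : p = u.pos :=
  ext_fn (EventuallyEq.trans h u.fn_pos.symm)

theorem isPosPart_pos (u : H1rad) : IsPosPart u u.pos := u.fn_pos

theorem isNegPart_neg_pos_neg (u : H1rad) : IsNegPart u (-(-u).pos) := by
  filter_upwards [fn_neg (-u).pos, (-u).fn_pos, fn_neg u] with x h1 h2 h3
  rw [h1, Pi.neg_apply, h2, h3, Pi.neg_apply, ← neg_zero (G := ℝ), max_neg_neg, neg_neg, neg_zero]

theorem eq_of_isNegPart {u m : H1rad} (h : IsNegPart u m) : m = -(-u).pos :=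
  ext_fn (EventuallyEq.trans h (EventuallyEq.symm u.isNegPart_neg_pos_neg))

end H1rad

/-! ### Quartic forms -/

/-- A bounded quadrilinear form `q` with the symmetries of a product of a symmetric bilinear
density `(a, b) ↦ ab` with itself: `q (a, b, c, d)` depends only on the unordered pair of the
unordered pairs `{a, b}` and `{c, d}`. -/
structure IsQuarticForm {H : Type*} [NormedAddCommGroup H] [NormedSpace ℝ H]
    (q : H → H → H → H → ℝ) : Prop where
  comm_left : ∀ a b c d, q a b c d = q b a c d
  symm : ∀ a b c d, q a b c d = q c d a b
  add_right : ∀ a b c d d', q a b c (d + d') = q a b c d + q a b c d'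
  smul_right : ∀ (t : ℝ) a b c d, q a b c (t • d) = t * q a b c d
  bound : ∃ C : ℝ, 0 ≤ C ∧ ∀ a b c d, |q a b c d| ≤ C * ‖a‖ * ‖b‖ * ‖c‖ * ‖d‖

namespace IsQuarticForm

variable {H : Type*} [NormedAddCommGroup H] [NormedSpace ℝ H] {q : H → H → H → H → ℝ}

theorem comm_right (h : IsQuarticForm q) (a b c d : H) : q a b c d = q a b d c := by
  rw [h.symm, h.comm_left, h.symm]

theorem exists_clm (h : IsQuarticForm q) :
    ∃ B : H →L[ℝ] H →L[ℝ] H →L[ℝ] H →L[ℝ] ℝ, ∀ a b c d, B a b c d = q a b c d := by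
  obtain ⟨C, hC0, hC⟩ := h.bound
  have add3 : ∀ a b c c' d : H, q a b (c + c') d = q a b c d + q a b c' d := fun a b c c' d => by
    simp only [h.comm_right a b _ d, h.add_right]
  have smul3 : ∀ (t : ℝ) (a b c d : H), q a b (t • c) d = t * q a b c d := fun t a b c d => by
    simp only [h.comm_right a b _ d, h.smul_right]
  have add2 : ∀ a b b' c d : H, q a (b + b') c d = q a b c d + q a b' c d :=
    fun a b b' c d => by simp only [h.symm a _ c d, h.add_right]
  have smul2 : ∀ (t : ℝ) (a b c d : H), q a (t • b) c d = t * q a b c d := fun t a b c d => by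
    simp only [h.symm a _ c d, h.smul_right]
  have add1 : ∀ a a' b c d : H, q (a + a') b c d = q a b c d + q a' b c d :=
    fun a a' b c d => by simp only [h.comm_left _ b c d, add2]
  have smul1 : ∀ (t : ℝ) (a b c d : H), q (t • a) b c d = t * q a b c d := fun t a b c d => by
    simp only [h.comm_left _ b c d, smul2]
  let L : H → H → H →L[ℝ] H →L[ℝ] ℝ := fun a b =>
    LinearMap.mkContinuous₂ (LinearMap.mk₂ ℝ (fun c d => q a b c d)
      (add3 a b) (fun t c d => smul3 t a b c d) (h.add_right a b)
      (fun t c d => h.smul_right t a b c d)) (C * ‖a‖ * ‖b‖) (hC a b)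
  have hL : ∀ a b c d, L a b c d = q a b c d := fun a b c d => rfl
  have hLn : ∀ a b, ‖L a b‖ ≤ C * ‖a‖ * ‖b‖ := fun a b =>
    LinearMap.mkContinuous₂_norm_le _ (by positivity) _
  refine ⟨LinearMap.mkContinuous₂ (LinearMap.mk₂ ℝ L ?_ ?_ ?_ ?_) C hLn, fun a b c d => rfl⟩
  · intro a a' b
    ext c d
    simp only [add_apply, hL, add1]
  · intro t a b
    ext c d
    simp only [smul_apply, hL, smul1, smul_eq_mul]
  · intro a b b'
    ext c d
    simp only [add_apply, hL, add2]
  · intro t a b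
    ext c d
    simp only [smul_apply, hL, smul2, smul_eq_mul]

theorem exists_hasFDerivAt (h : IsQuarticForm q) (w : H) : ∃ D : H →L[ℝ] ℝ,
    HasFDerivAt (fun u => q u u u u) D w ∧ ∀ v, D v = 4 * q w w w v := by
  obtain ⟨B, hB⟩ := h.exists_clm
  simp only [← hB]
  have hid := hasFDerivAt_id (𝕜 := ℝ) w
  have hd := (((B.hasFDerivAt.clm_apply hid).clm_apply hid).clm_apply hid)
  refine ⟨_, hd, fun v => ?_⟩
  simp [hB]
  rw [h.symm v, h.comm_right w w v, h.symm w v, h.comm_right w w w v]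
  ring

theorem continuous_cubic (h : IsQuarticForm q) : Continuous fun z : H × H => q z.1 z.1 z.1 z.2 := by
  obtain ⟨B, hB⟩ := h.exists_clm
  simp only [← hB]
  fun_prop

theorem neg_cubic (h : IsQuarticForm q) (w v : H) : q (-w) (-w) (-w) v = -q w w w v := by
  obtain ⟨B, hB⟩ := h.exists_clm
  simp [← hB]

/-- Expansion of `q (w, w, w, w)` and `q (w, w, w, p)` at `w = s p - t n` when the products
involving `p n` vanish. -/
theorem expand (h : IsQuarticForm q) {p n : H} (h0 : ∀ a b, q a b p n = 0) (s t : ℝ) :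
    q (s • p - t • n) (s • p - t • n) (s • p - t • n) (s • p - t • n) =
      s ^ 4 * q p p p p + 2 * s ^ 2 * t ^ 2 * q p p n n + t ^ 4 * q n n n n ∧
    q (s • p - t • n) (s • p - t • n) (s • p - t • n) p =
      s ^ 3 * q p p p p + s * t ^ 2 * q p p n n := by
  obtain ⟨B, hB⟩ := h.exists_clm
  have h1 : ∀ a b, q a b n p = 0 := fun a b => by rw [h.comm_right, h0]
  have h2 : ∀ a b, q p n a b = 0 := fun a b => by rw [h.symm, h0]
  have h3 : ∀ a b, q n p a b = 0 := fun a b => by rw [h.symm, h1]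
  have h4 : q n n p p = q p p n n := h.symm _ _ _ _
  simp only [← hB] at h0 h1 h2 h3 h4 ⊢
  constructor <;>
  · simp only [map_sub, map_smul, sub_apply, smul_apply,
      smul_eq_mul, h0, h1, h2, h3, h4]
    ring

end IsQuarticForm

/-! ### The Coulomb energy -/

theorem integral_abs_mul_le {α : Type*} [MeasurableSpace α] {μ : Measure α} {f g : α → ℝ}
    (hf : MemLp f 2 μ) (hg : MemLp g 2 μ) :
    ∫ x, |f x| * |g x| ∂μ ≤ √(∫ x, f x ^ 2 ∂μ) * √(∫ x, g x ^ 2 ∂μ) := by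
  have h := integral_mul_norm_le_Lp_mul_Lq (μ := μ) Real.HolderConjugate.two_two
    (by simpa using hf) (by simpa using hg)
  simpa [Real.sqrt_eq_rpow] using h

theorem H1rad.memLp_fn_mul (a b : H1rad) : MemLp (fun x => a.fn x * b.fn x) 2 volume := by
  have h : ∀ c : H1rad, MemLp (fun x => c.fn x ^ 2) 2 volume := fun c =>
    (memLp_two_iff_integrable_sq (c.aesm_fn.pow 2)).2
      (c.integrable_fn_four.congr (Eventually.of_forall fun x => by simp only [Pi.pow_apply]; ring))
  refine (memLp_two_iff_integrable_sq (a.aesm_fn.mul b.aesm_fn)).2 ?_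
  refine (MemLp.integrable_mul (p := 2) (q := 2) (h a) (h b)).congr
    (Eventually.of_forall fun x => ?_)
  simp only [Pi.mul_apply]
  ring

theorem H1rad.integrable_fn_mul (a b : H1rad) : Integrable (fun x => a.fn x * b.fn x) volume :=
  MemLp.integrable_mul (p := 2) (q := 2) a.memLp_fn b.memLp_fn

theorem H1rad.integral_abs_fn_mul_le (a b : H1rad) :
    ∫ x, |a.fn x * b.fn x| ≤ ‖a‖ * ‖b‖ := by
  simp only [abs_mul]
  refine (integral_abs_mul_le a.memLp_fn b.memLp_fn).trans ?_
  gcongr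
  · exact Real.sqrt_le_iff.2 ⟨norm_nonneg _, a.integral_fn_sq_le⟩
  · exact Real.sqrt_le_iff.2 ⟨norm_nonneg _, b.integral_fn_sq_le⟩

theorem H1rad.exists_sqrt_integral_sq_mul_sq_le :
    ∃ K : ℝ, 0 ≤ K ∧ ∀ a b : H1rad, √(∫ x, (a.fn x * b.fn x) ^ 2) ≤ K * (‖a‖ * ‖b‖) := by
  obtain ⟨K, hK0, hK⟩ := H1rad.exists_integral_four_bound
  refine ⟨√K, Real.sqrt_nonneg _, fun a b => ?_⟩
  have h : ∀ c : H1rad, MemLp (fun x => c.fn x ^ 2) 2 volume := fun c => by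
    simpa only [sq] using c.memLp_fn_mul c
  have h1 := integral_abs_mul_le (h a) (h b)
  have e : ∀ c : H1rad, √(∫ x, (c.fn x ^ 2) ^ 2) ≤ √K * ‖c‖ ^ 2 := fun c => by
    refine Real.sqrt_le_iff.2 ⟨by positivity, ?_⟩
    rw [mul_pow, Real.sq_sqrt hK0, ← pow_mul]
    simp only [← pow_mul]
    exact hK c
  refine Real.sqrt_le_iff.2 ⟨by positivity, ?_⟩
  calc ∫ x, (a.fn x * b.fn x) ^ 2 = ∫ x, |a.fn x ^ 2| * |b.fn x ^ 2| := by
        congr 1 with x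
        rw [abs_of_nonneg (sq_nonneg _), abs_of_nonneg (sq_nonneg _), mul_pow]
    _ ≤ _ := h1
    _ ≤ (√K * ‖a‖ ^ 2) * (√K * ‖b‖ ^ 2) := by gcongr <;> exact e _
    _ = _ := by ring

/-- The Coulomb kernel `1 / (4π|z|)`. -/
noncomputable def coulombKernel (z : E3) : ℝ := 1 / (4 * Real.pi * ‖z‖)

theorem coulombKernel_nonneg (z : E3) : 0 ≤ coulombKernel z := by
  unfold coulombKernel
  positivity

theorem measurable_coulombKernel : Measurable coulombKernel := by
  unfold coulombKernel
  fun_prop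

theorem coulombKernel_neg (z : E3) : coulombKernel (-z) = coulombKernel z := by
  simp [coulombKernel]

/-- The singular part of the Coulomb kernel. -/
noncomputable def coulombNear : E3 → ℝ := (Metric.ball (0 : E3) 1).indicator coulombKernel

theorem coulombNear_nonneg (z : E3) : 0 ≤ coulombNear z :=
  indicator_nonneg (fun z _ => coulombKernel_nonneg z) z

theorem coulombKernel_le (z : E3) : coulombKernel z ≤ coulombNear z + 1 := by
  unfold coulombNear
  by_cases hz : z ∈ Metric.ball (0 : E3) 1
  · simp [hz]
  · rw [indicator_of_notMem hz, zero_add, coulombKernel]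
    have h1 : 1 ≤ ‖z‖ := by simpa using hz
    refine div_le_one_of_le₀ ?_ (by positivity)
    nlinarith [Real.pi_gt_three]

theorem memLp_coulombNear : MemLp coulombNear 2 volume := by
  have hm : Measurable coulombNear := measurable_coulombKernel.indicator measurableSet_ball
  refine (memLp_two_iff_integrable_sq hm.aestronglyMeasurable).2 ?_
  let h : ℝ → ℝ := fun r => (Iio (1 : ℝ)).indicator (fun r => (1 / (4 * Real.pi * r)) ^ 2) r
  have e : (fun z => coulombNear z ^ 2) = fun z : E3 => h ‖z‖ := by
    funext z
    simp only [coulombNear, h]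
    by_cases hz : ‖z‖ < 1
    · rw [indicator_of_mem (by simpa using hz), indicator_of_mem (by simpa using hz),
        coulombKernel]
    · rw [indicator_of_notMem (by simpa using hz), indicator_of_notMem (by simpa using hz)]
      simp
  rw [e, integrable_fun_norm_addHaar volume (f := h)]
  have e2 : ∀ r ∈ Ioi (0 : ℝ), r ^ (Module.finrank ℝ E3 - 1) • h r =
      (Iio (1 : ℝ)).indicator (fun _ => (1 / (4 * Real.pi)) ^ 2) r := by
    intro r hr
    have hr0 : r ≠ 0 := ne_of_gt hr
    by_cases h1 : r ∈ Iio (1 : ℝ)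
    · simp only [h, indicator_of_mem h1, finrank_euclideanSpace, Fintype.card_fin, smul_eq_mul]
      field_simp
    · simp [h, indicator_of_notMem h1]
  rw [integrableOn_congr_fun e2 measurableSet_Ioi, IntegrableOn,
    integrable_indicator_iff measurableSet_Iio]
  refine integrableOn_const ?_
  rw [Measure.restrict_apply measurableSet_Iio, Iio_inter_Ioi]
  simp

/-- The potential of the charge density `a b`. -/
noncomputable def coulombPotential (a b : H1rad) (x : E3) : ℝ :=
  ∫ y, coulombKernel (x - y) * (a.fn y * b.fn y)

/-- The potential of `a b` is uniformly bounded: near the singularity both the kernel and `a b` are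
square integrable, and away from it the kernel is bounded and `a b` integrable. -/
theorem exists_coulomb_bound : ∃ C : ℝ, 0 ≤ C ∧ ∀ (a b : H1rad) (x : E3),
    Integrable (fun y => coulombKernel (x - y) * (a.fn y * b.fn y)) ∧
    ∫ y, |coulombKernel (x - y) * (a.fn y * b.fn y)| ≤ C * (‖a‖ * ‖b‖) := by
  obtain ⟨K, hK0, hK⟩ := H1rad.exists_sqrt_integral_sq_mul_sq_le
  refine ⟨√(∫ z, coulombNear z ^ 2) * K + 1, by positivity, fun a b x => ?_⟩
  have hn : MemLp (fun y => coulombNear (x - y)) 2 volume :=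
    memLp_coulombNear.comp_measurePreserving (Measure.measurePreserving_sub_left volume x)
  have hab := a.memLp_fn_mul b
  have h1 : Integrable (fun y => |coulombNear (x - y)| * |a.fn y * b.fn y|) :=
    MemLp.integrable_mul (p := 2) (q := 2) hn.abs hab.abs
  have h2 : Integrable (fun y => |a.fn y * b.fn y|) := (a.integrable_fn_mul b).abs
  have hle : ∀ y, |coulombKernel (x - y) * (a.fn y * b.fn y)| ≤
      |coulombNear (x - y)| * |a.fn y * b.fn y| + |a.fn y * b.fn y| := fun y => by
    rw [abs_mul, abs_of_nonneg (coulombKernel_nonneg _), abs_of_nonneg (coulombNear_nonneg _)]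
    have := mul_le_mul_of_nonneg_right (coulombKernel_le (x - y)) (abs_nonneg (a.fn y * b.fn y))
    linarith
  have hint : Integrable (fun y => coulombKernel (x - y) * (a.fn y * b.fn y)) :=
    (h1.add h2).mono' ((measurable_coulombKernel.comp
      (measurable_const.sub measurable_id)).aestronglyMeasurable.mul hab.1)
      (Eventually.of_forall hle)
  refine ⟨hint, ?_⟩
  calc ∫ y, |coulombKernel (x - y) * (a.fn y * b.fn y)|
      ≤ ∫ y, (|coulombNear (x - y)| * |a.fn y * b.fn y| + |a.fn y * b.fn y|) :=
        integral_mono hint.abs (h1.add h2) hle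
    _ = (∫ y, |coulombNear (x - y)| * |a.fn y * b.fn y|) + ∫ y, |a.fn y * b.fn y| :=
        integral_add h1 h2
    _ ≤ √(∫ z, coulombNear z ^ 2) * (K * (‖a‖ * ‖b‖)) + ‖a‖ * ‖b‖ := by
        gcongr ?_ + ?_
        · refine (integral_abs_mul_le hn hab).trans ?_
          rw [integral_sub_left_eq_self (fun z => coulombNear z ^ 2) volume x]
          gcongr
          exact hK a b
        · exact a.integral_abs_fn_mul_le b
    _ = _ := by ring

theorem integrable_coulomb (a b : H1rad) (x : E3) :
    Integrable (fun y => coulombKernel (x - y) * (a.fn y * b.fn y)) := by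
  obtain ⟨C, -, hC⟩ := exists_coulomb_bound
  exact (hC a b x).1

theorem aesm_coulomb_prod (a b c d : H1rad) : AEStronglyMeasurable
    (fun z : E3 × E3 => coulombKernel (z.1 - z.2) * (a.fn z.2 * b.fn z.2) *
      (c.fn z.1 * d.fn z.1)) (volume.prod volume) :=
  ((measurable_coulombKernel.comp (measurable_fst.sub measurable_snd)).aestronglyMeasurable.mul
    (a.aesm_fn.comp_snd.mul b.aesm_fn.comp_snd)).mul (c.aesm_fn.comp_fst.mul d.aesm_fn.comp_fst)

theorem integrable_coulomb_prod (a b c d : H1rad) : Integrable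
    (fun z : E3 × E3 => coulombKernel (z.1 - z.2) * (a.fn z.2 * b.fn z.2) *
      (c.fn z.1 * d.fn z.1)) (volume.prod volume) := by
  obtain ⟨C, -, hC⟩ := exists_coulomb_bound
  have hm := aesm_coulomb_prod a b c d
  refine (integrable_prod_iff hm).2 ⟨Eventually.of_forall fun x =>
    (integrable_coulomb a b x).mul_const (c.fn x * d.fn x), ?_⟩
  refine (((c.integrable_fn_mul d).abs).const_mul (C * (‖a‖ * ‖b‖))).mono'
    hm.norm.integral_prod_right' (Eventually.of_forall fun x => ?_)
  simp only [norm_mul (_ * _) (c.fn x * d.fn x)]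
  rw [integral_mul_const, norm_mul, norm_norm, Real.norm_of_nonneg
    (integral_nonneg fun y => norm_nonneg _)]
  exact mul_le_mul_of_nonneg_right (hC a b x).2 (norm_nonneg _)

/-- The Coulomb energy `∫∫ (ab)(y) (cd)(x) / (4π|x - y|)`. -/
noncomputable def coulombForm (a b c d : H1rad) : ℝ :=
  ∫ x, coulombPotential a b x * (c.fn x * d.fn x)

theorem coulombPotential_mul (a b c d : H1rad) (x : E3) :
    coulombPotential a b x * (c.fn x * d.fn x) =
      ∫ y, coulombKernel (x - y) * (a.fn y * b.fn y) * (c.fn x * d.fn x) :=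
  (integral_mul_const _ _).symm

theorem integrable_coulombPotential_mul (a b c d : H1rad) :
    Integrable (fun x => coulombPotential a b x * (c.fn x * d.fn x)) := by
  simp only [coulombPotential_mul]
  exact (integrable_coulomb_prod a b c d).integral_prod_left

theorem exists_coulombForm_bound : ∃ C : ℝ, 0 ≤ C ∧ ∀ a b c d : H1rad,
    |coulombForm a b c d| ≤ C * ‖a‖ * ‖b‖ * ‖c‖ * ‖d‖ := by
  obtain ⟨C, hC0, hC⟩ := exists_coulomb_bound
  refine ⟨C, hC0, fun a b c d => ?_⟩
  have hp : ∀ x, |coulombPotential a b x| ≤ C * (‖a‖ * ‖b‖) := fun x =>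
    (abs_integral_le_integral_abs).trans (hC a b x).2
  calc |coulombForm a b c d| ≤ ∫ x, |coulombPotential a b x * (c.fn x * d.fn x)| :=
        abs_integral_le_integral_abs
    _ ≤ ∫ x, C * (‖a‖ * ‖b‖) * |c.fn x * d.fn x| := by
        refine integral_mono (integrable_coulombPotential_mul a b c d).abs
          ((c.integrable_fn_mul d).abs.const_mul _) fun x => ?_
        rw [abs_mul]
        exact mul_le_mul_of_nonneg_right (hp x) (abs_nonneg _)
    _ = C * (‖a‖ * ‖b‖) * ∫ x, |c.fn x * d.fn x| := integral_const_mul _ _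
    _ ≤ C * (‖a‖ * ‖b‖) * (‖c‖ * ‖d‖) := by gcongr; exact c.integral_abs_fn_mul_le d
    _ = _ := by ring

theorem coulombForm_comm_left (a b c d : H1rad) : coulombForm a b c d = coulombForm b a c d := by
  simp only [coulombForm, coulombPotential, mul_comm (a.fn _)]

theorem coulombForm_symm (a b c d : H1rad) : coulombForm a b c d = coulombForm c d a b := by
  simp only [coulombForm, coulombPotential_mul]
  rw [integral_integral_swap (integrable_coulomb_prod a b c d)]
  congr 1 with x
  congr 1 with y
  rw [← neg_sub, coulombKernel_neg]
  ring

theorem coulombForm_add_right (a b c d d' : H1rad) :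
    coulombForm a b c (d + d') = coulombForm a b c d + coulombForm a b c d' := by
  rw [coulombForm, coulombForm, coulombForm, ← integral_add
    (integrable_coulombPotential_mul a b c d) (integrable_coulombPotential_mul a b c d')]
  refine integral_congr_ae ?_
  filter_upwards [H1rad.fn_add d d'] with x hx
  rw [hx, Pi.add_apply]
  ring

theorem coulombForm_smul_right (t : ℝ) (a b c d : H1rad) :
    coulombForm a b c (t • d) = t * coulombForm a b c d := by
  rw [coulombForm, coulombForm, ← integral_const_mul]
  refine integral_congr_ae ?_
  filter_upwards [H1rad.fn_smul t d] with x hx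
  rw [hx, Pi.smul_apply, smul_eq_mul]
  ring

theorem isQuarticForm_coulombForm : IsQuarticForm coulombForm :=
  ⟨coulombForm_comm_left, coulombForm_symm, coulombForm_add_right, coulombForm_smul_right,
    exists_coulombForm_bound⟩

theorem integral_poissonPotential (u : H1rad) :
    ∫ x, poissonPotential u.fn x * u.fn x ^ 2 = coulombForm u u u u := by
  simp only [coulombForm, coulombPotential, poissonPotential, coulombKernel, sq]

theorem coulombForm_nonneg (a b : H1rad) : 0 ≤ coulombForm a a b b := by
  refine integral_nonneg fun x => mul_nonneg (integral_nonneg fun y => ?_) (mul_self_nonneg _)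
  exact mul_nonneg (coulombKernel_nonneg _) (mul_self_nonneg _)

theorem coulombForm_eq_zero_of_mul_eq_zero {a b : H1rad} (h : ∀ᵐ x, a.fn x * b.fn x = 0)
    (c d : H1rad) : coulombForm c d a b = 0 := by
  refine integral_eq_zero_of_ae ?_
  filter_upwards [h] with x hx
  simp [hx]

/-! ### The local nonlinearity -/

/-- Growth of `f`: at most linear near the origin and cubic at infinity. On compact sets away from
the origin, continuity suffices. -/
theorem exists_growth {f : ℝ → ℝ} (hf : Continuous f) (hodd : ∀ t : ℝ, f t = -f (-t))
    (h0 : Tendsto (fun t : ℝ => f t / t) (𝓝[≠] 0) (𝓝 0))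
    (hinf : Tendsto (fun t : ℝ => f t / t ^ 3) atTop (𝓝 1)) :
    ∃ C : ℝ, 0 ≤ C ∧ ∀ t, |f t| ≤ C * (|t| + |t| ^ 3) := by
  obtain ⟨δ, hδ0, hδ⟩ : ∃ δ > 0, ∀ t : ℝ, |t| < δ → |f t| ≤ |t| := by
    have h1 : ∀ᶠ t in 𝓝[≠] (0 : ℝ), |f t / t| < 1 := by
      simpa using h0.abs.eventually_lt_const (by simp : |(0 : ℝ)| < 1)
    obtain ⟨δ, hδ0, hδ⟩ := Metric.mem_nhdsWithin_iff.1 h1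
    refine ⟨δ, hδ0, fun t ht => ?_⟩
    rcases eq_or_ne t 0 with rfl | ht0
    · have := hodd 0
      rw [neg_zero] at this
      have : f 0 = 0 := by linarith
      simp [this]
    · have h2 : |f t / t| < 1 := hδ ⟨by simpa using ht, ht0⟩
      rw [abs_div, div_lt_one (abs_pos.2 ht0)] at h2
      exact h2.le
  obtain ⟨T, hT⟩ : ∃ T, ∀ t : ℝ, T ≤ t → f t / t ^ 3 < 2 ∧ -2 < f t / t ^ 3 := by
    have h1 := (hinf.eventually_lt_const (by norm_num : (1 : ℝ) < 2)).and
      (hinf.eventually_const_lt (by norm_num : (-2 : ℝ) < 1))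
    exact eventually_atTop.1 h1
  obtain ⟨M, hM⟩ := (isCompact_Icc (a := -max T 1) (b := max T 1)).exists_bound_of_continuousOn
    hf.continuousOn
  have hM0 : 0 ≤ M := (norm_nonneg _).trans (hM 0 (by simp))
  have habs : ∀ t, |f t| = |f (|t|)| := fun t => by
    rcases abs_choice t with h | h
    · rw [h]
    · rw [h, hodd t, abs_neg]
  refine ⟨1 + 2 + M / δ, by positivity, fun t => ?_⟩
  have ht0 : 0 ≤ |t| := abs_nonneg t
  have ht3 : 0 ≤ |t| ^ 3 := by positivity
  have hMδ : 0 ≤ M / δ := by positivity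
  rcases lt_or_ge (|t|) δ with h | h
  · nlinarith [hδ t h, mul_nonneg hMδ ht0, mul_nonneg hMδ ht3]
  · rcases le_total (|t|) (max T 1) with h2 | h2
    · have h3 : |f t| ≤ M := hM t (abs_le.1 h2)
      have h4 : M ≤ M / δ * |t| := by
        rw [div_mul_eq_mul_div, le_div_iff₀ hδ0]
        exact mul_le_mul_of_nonneg_left h hM0
      nlinarith [mul_nonneg hMδ ht3]
    · have h1 : (1 : ℝ) ≤ |t| := (le_max_right _ _).trans h2
      have h3 := hT (|t|) ((le_max_left _ _).trans h2)
      have hp : 0 < |t| ^ 3 := by positivity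
      rw [div_lt_iff₀ hp, lt_div_iff₀ hp] at h3
      have h4 : |f (|t|)| ≤ 2 * |t| ^ 3 := abs_le.2 ⟨by linarith [h3.2], h3.1.le⟩
      rw [habs]
      nlinarith [mul_nonneg hMδ ht0, mul_nonneg hMδ ht3]

theorem hasDerivAt_primitiveF {f : ℝ → ℝ} (hf : Continuous f) (t : ℝ) :
    HasDerivAt (primitiveF f) (f t) t :=
  intervalIntegral.integral_hasDerivAt_right (hf.intervalIntegrable _ _)
    (hf.stronglyMeasurableAtFilter _ _) hf.continuousAt

theorem continuous_primitiveF {f : ℝ → ℝ} (hf : Continuous f) : Continuous (primitiveF f) :=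
  continuous_iff_continuousAt.2 fun t => (hasDerivAt_primitiveF hf t).continuousAt

theorem primitiveF_neg {f : ℝ → ℝ} (hodd : ∀ t : ℝ, f t = -f (-t)) (t : ℝ) :
    primitiveF f (-t) = primitiveF f t := by
  have h : ∫ x in (0 : ℝ)..t, f (-x) = ∫ x in -t..0, f x := by
    simp
  have h2 : ∫ x in (0 : ℝ)..t, f (-x) = -∫ x in (0 : ℝ)..t, f x := by
    rw [← intervalIntegral.integral_neg]
    congr 1 with x
    rw [hodd x, neg_neg]
  rw [primitiveF, primitiveF, intervalIntegral.integral_symm, ← h, h2, neg_neg]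

/-- Mean value theorem for the primitive. -/
theorem exists_primitiveF_add {f : ℝ → ℝ} (hf : Continuous f) (a d : ℝ) :
    ∃ ξ, |ξ| ≤ |a| + |d| ∧ primitiveF f (a + d) - primitiveF f a = f ξ * d := by
  have hD : ∀ s : ℝ, HasDerivAt (fun s => primitiveF f (a + s * d)) (f (a + s * d) * d) s := by
    intro s
    have h1 : HasDerivAt (fun s : ℝ => a + s * d) d s := by
      simpa using ((hasDerivAt_id s).mul_const d).const_add a
    exact (hasDerivAt_primitiveF hf (a + s * d)).comp s h1
  obtain ⟨s, hs, h⟩ := exists_hasDerivAt_eq_slope (fun s => primitiveF f (a + s * d))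
    (fun s => f (a + s * d) * d) (a := 0) (b := 1) one_pos
    (fun s _ => (hD s).continuousAt.continuousWithinAt) (fun s _ => hD s)
  refine ⟨a + s * d, (abs_add_le _ _).trans ?_, by simpa using h.symm⟩
  rw [abs_mul, abs_of_pos hs.1]
  have := mul_le_mul_of_nonneg_right hs.2.le (abs_nonneg d)
  linarith

section Nonlinearity

variable {f : ℝ → ℝ} {C : ℝ}

theorem abs_mul_le_of_growth (hfb : ∀ t, |f t| ≤ C * (|t| + |t| ^ 3)) (hC : 0 ≤ C) (a b : ℝ) :
    |f a * b| ≤ C * (a ^ 2 + b ^ 2 + a ^ 4 + b ^ 4) := by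
  have h1 := mul_le_mul_of_nonneg_right (hfb a) (abs_nonneg b)
  have h2 : |a| * |b| ≤ a ^ 2 + b ^ 2 := by
    nlinarith [sq_abs a, sq_abs b, sq_nonneg (|a| - |b|)]
  have h3 : |a| ^ 3 * |b| ≤ a ^ 4 + b ^ 4 := by
    have e1 : a ^ 4 = |a| ^ 4 := (Even.pow_abs (by decide) a).symm
    have e2 : b ^ 4 = |b| ^ 4 := (Even.pow_abs (by decide) b).symm
    rw [e1, e2]
    have ha := abs_nonneg a
    have hb := abs_nonneg b
    rcases le_total (|a|) (|b|) with h | h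
    · have : |a| ^ 3 * |b| ≤ |b| ^ 3 * |b| := by gcongr
      nlinarith [pow_nonneg ha 4]
    · have : |a| ^ 3 * |b| ≤ |a| ^ 3 * |a| := by gcongr
      nlinarith [pow_nonneg hb 4]
  rw [abs_mul]
  nlinarith [mul_le_mul_of_nonneg_left h2 hC, mul_le_mul_of_nonneg_left h3 hC]

theorem abs_primitiveF_le (hf : Continuous f) (hfb : ∀ t, |f t| ≤ C * (|t| + |t| ^ 3))
    (hC : 0 ≤ C) (t : ℝ) : |primitiveF f t| ≤ C * (t ^ 2 + t ^ 4) := by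
  obtain ⟨ξ, hξ, h⟩ := exists_primitiveF_add hf 0 t
  have h0 : primitiveF f 0 = 0 := by simp [primitiveF]
  rw [h0, zero_add, sub_zero] at h
  rw [abs_zero, zero_add] at hξ
  rw [h, abs_mul]
  calc |f ξ| * |t| ≤ C * (|ξ| + |ξ| ^ 3) * |t| := by gcongr; exact hfb ξ
    _ ≤ C * (|t| + |t| ^ 3) * |t| := by gcongr
    _ = C * (t ^ 2 + t ^ 4) := by
      have e1 : t ^ 4 = |t| ^ 4 := (Even.pow_abs (by decide) t).symm
      rw [e1, ← sq_abs t]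
      ring

theorem integrable_primitiveF (hf : Continuous f) (hfb : ∀ t, |f t| ≤ C * (|t| + |t| ^ 3))
    (hC : 0 ≤ C) (u : H1rad) : Integrable (fun x => primitiveF f (u.fn x)) :=
  ((u.integrable_fn_sq.add u.integrable_fn_four).const_mul C).mono'
    ((continuous_primitiveF hf).comp_aestronglyMeasurable u.aesm_fn)
    (Eventually.of_forall fun x => abs_primitiveF_le hf hfb hC (u.fn x))

theorem integrable_nonlinearity (hf : Continuous f) (hfb : ∀ t, |f t| ≤ C * (|t| + |t| ^ 3))
    (hC : 0 ≤ C) (u v : H1rad) : Integrable (fun x => f (u.fn x) * v.fn x) :=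
  ((((u.integrable_fn_sq.add v.integrable_fn_sq).add u.integrable_fn_four).add
    v.integrable_fn_four).const_mul C).mono'
    ((hf.comp_aestronglyMeasurable u.aesm_fn).mul v.aesm_fn)
    (Eventually.of_forall fun x => abs_mul_le_of_growth hfb hC (u.fn x) (v.fn x))

theorem tendsto_integral_four {w : ℕ → H1rad} {u : H1rad} (h : Tendsto w atTop (𝓝 u)) :
    Tendsto (fun n => ∫ x, ((w n - u).fn x ^ 2 + (w n - u).fn x ^ 4)) atTop (𝓝 0) := by
  obtain ⟨K, hK0, hK⟩ := H1rad.exists_integral_four_bound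
  have h1 := tendsto_iff_norm_sub_tendsto_zero.1 h
  have h2 : Tendsto (fun n => ‖w n - u‖ ^ 2 + K * ‖w n - u‖ ^ 4) atTop (𝓝 0) := by
    simpa using (h1.pow 2).add ((h1.pow 4).const_mul K)
  refine squeeze_zero (fun n => integral_nonneg fun x => by positivity) (fun n => ?_) h2
  rw [integral_add (w n - u).integrable_fn_sq (w n - u).integrable_fn_four]
  exact add_le_add (w n - u).integral_fn_sq_le (hK _)

theorem sq_le_sub_add (a b : ℝ) : a ^ 2 ≤ 8 * (a - b) ^ 2 + 8 * b ^ 2 := by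
  nlinarith [sq_nonneg (a - 2 * b), sq_nonneg (a - b), sq_nonneg b]

theorem pow_four_le_sub_add (a b : ℝ) : a ^ 4 ≤ 8 * (a - b) ^ 4 + 8 * b ^ 4 := by
  have h1 : a ^ 2 ≤ 2 * ((a - b) ^ 2 + b ^ 2) := by nlinarith [sq_nonneg (a - 2 * b)]
  have h2 := pow_le_pow_left₀ (sq_nonneg a) h1 2
  nlinarith [sq_nonneg ((a - b) ^ 2 - b ^ 2)]

/-- Joint continuity of `(u, v) ↦ ∫ f(u) v` on `H¹_rad × H¹_rad`. -/
theorem continuous_nonlinearity (hf : Continuous f) (hfb : ∀ t, |f t| ≤ C * (|t| + |t| ^ 3))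
    (hC : 0 ≤ C) : Continuous fun z : H1rad × H1rad => ∫ x, f (z.1.fn x) * z.2.fn x := by
  refine continuous_iff_continuousAt.2 fun z => ?_
  refine tendsto_of_seq_tendsto fun y hy => tendsto_of_subseq_tendsto fun ns hns => ?_
  have hy' := hy.comp hns
  obtain ⟨ms, hms, hae1⟩ := H1rad.exists_subseq_ae ((continuous_fst.tendsto z).comp hy')
  have hy1 := hy'.comp hms.tendsto_atTop
  obtain ⟨ls, hls, hae2⟩ := H1rad.exists_subseq_ae ((continuous_snd.tendsto z).comp hy1)
  have hy2 := hy1.comp hls.tendsto_atTop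
  refine ⟨ms ∘ ls, ?_⟩
  let w : ℕ → H1rad := fun k => (y (ns (ms (ls k)))).1
  let v : ℕ → H1rad := fun k => (y (ns (ms (ls k)))).2
  have hw : Tendsto w atTop (𝓝 z.1) := (continuous_fst.tendsto z).comp hy2
  have hv : Tendsto v atTop (𝓝 z.2) := (continuous_snd.tendsto z).comp hy2
  have haew : ∀ᵐ x, Tendsto (fun k => (w k).fn x) atTop (𝓝 (z.1.fn x)) :=
    hae1.mono fun x hx => hx.comp hls.tendsto_atTop
  have hlim := ((tendsto_integral_four hw).add (tendsto_integral_four hv)).const_mul (8 * C)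
  have hi : ∀ a : H1rad, Integrable (fun x => a.fn x ^ 2 + a.fn x ^ 4) := fun a =>
    a.integrable_fn_sq.add a.integrable_fn_four
  refine tendsto_integral_of_le_add (f := fun k x => f ((w k).fn x) * (v k).fn x)
    (e := fun k x => 8 * C * (((w k - z.1).fn x ^ 2 + (w k - z.1).fn x ^ 4) +
      ((v k - z.2).fn x ^ 2 + (v k - z.2).fn x ^ 4)))
    (b := fun x => 9 * C * ((z.1.fn x ^ 2 + z.1.fn x ^ 4) + (z.2.fn x ^ 2 + z.2.fn x ^ 4)))
    (fun k => integrable_nonlinearity hf hfb hC _ _) (integrable_nonlinearity hf hfb hC _ _)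
    (fun k => ((hi _).add (hi _)).const_mul _) (fun k x => by positivity)
    (((hi _).add (hi _)).const_mul _) (fun k => ?_) ?_ ?_
  · filter_upwards [H1rad.fn_sub (w k) z.1, H1rad.fn_sub (v k) z.2] with x h1 h2
    rw [h1, h2, Pi.sub_apply, Pi.sub_apply]
    have k1 := abs_mul_le_of_growth hfb hC ((w k).fn x) ((v k).fn x)
    have k2 := abs_mul_le_of_growth hfb hC (z.1.fn x) (z.2.fn x)
    have k3 := abs_sub (f ((w k).fn x) * (v k).fn x) (f (z.1.fn x) * z.2.fn x)
    have k4 := mul_le_mul_of_nonneg_left (add_le_add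
      (add_le_add (sq_le_sub_add ((w k).fn x) (z.1.fn x)) (sq_le_sub_add ((v k).fn x) (z.2.fn x)))
      (add_le_add (pow_four_le_sub_add ((w k).fn x) (z.1.fn x))
        (pow_four_le_sub_add ((v k).fn x) (z.2.fn x)))) hC
    linarith
  · simp only [mul_zero, add_zero] at hlim
    refine hlim.congr fun k => ?_
    rw [integral_const_mul, integral_add (hi _) (hi _)]
  · filter_upwards [haew, hae2] with x h1 h2
    exact ((hf.tendsto _).comp h1).mul h2

theorem exists_nonlinearityCLM (hf : Continuous f) (hfb : ∀ t, |f t| ≤ C * (|t| + |t| ^ 3))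
    (hC : 0 ≤ C) (u : H1rad) : ∃ D : H1rad →L[ℝ] ℝ, ∀ v, D v = ∫ x, f (u.fn x) * v.fn x := by
  refine ⟨⟨⟨⟨fun v => ∫ x, f (u.fn x) * v.fn x, fun v v' => ?_⟩, fun t v => ?_⟩, ?_⟩, fun v => rfl⟩
  · rw [← integral_add (integrable_nonlinearity hf hfb hC u v)
      (integrable_nonlinearity hf hfb hC u v')]
    refine integral_congr_ae ?_
    filter_upwards [H1rad.fn_add v v'] with x hx
    rw [hx, Pi.add_apply, mul_add]
  · rw [RingHom.id_apply, smul_eq_mul, ← integral_const_mul]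
    refine integral_congr_ae ?_
    filter_upwards [H1rad.fn_smul t v] with x hx
    rw [hx, Pi.smul_apply, smul_eq_mul]
    ring
  · exact (continuous_nonlinearity hf hfb hC).comp (continuous_const.prodMk continuous_id)

/-- Bound for the first order remainder quotient of the primitive. -/
theorem abs_remainder_div_le (hf : Continuous f) (hfb : ∀ t, |f t| ≤ C * (|t| + |t| ^ 3))
    (hC : 0 ≤ C) (a d : ℝ) :
    |(primitiveF f (a + d) - primitiveF f a - d * f a) / d| ≤
      5 * C * (|a| + |a| ^ 3) + 4 * C * (|d| + |d| ^ 3) := by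
  have ha := abs_nonneg a
  have hd := abs_nonneg d
  rcases eq_or_ne d 0 with rfl | hd0
  · simp
    positivity
  obtain ⟨ξ, hξ, h⟩ := exists_primitiveF_add hf a d
  have e : (primitiveF f (a + d) - primitiveF f a - d * f a) / d = f ξ - f a := by
    rw [h]
    field_simp
  rw [e]
  have h1 : |ξ| + |ξ| ^ 3 ≤ 4 * (|a| + |a| ^ 3) + 4 * (|d| + |d| ^ 3) := by
    have : |ξ| ^ 3 ≤ (|a| + |d|) ^ 3 := pow_le_pow_left₀ (abs_nonneg _) hξ 3
    nlinarith [mul_nonneg (add_nonneg ha hd) (sq_nonneg (|a| - |d|))]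
  calc |f ξ - f a| ≤ |f ξ| + |f a| := abs_sub _ _
    _ ≤ C * (|ξ| + |ξ| ^ 3) + C * (|a| + |a| ^ 3) := add_le_add (hfb ξ) (hfb a)
    _ ≤ C * (4 * (|a| + |a| ^ 3) + 4 * (|d| + |d| ^ 3)) + C * (|a| + |a| ^ 3) := by gcongr
    _ = _ := by ring

theorem tendsto_remainder_div (hf : Continuous f) (a : ℝ) {d : ℕ → ℝ}
    (hd : Tendsto d atTop (𝓝 0)) :
    Tendsto (fun n => (primitiveF f (a + d n) - primitiveF f a - d n * f a) / d n) atTop (𝓝 0) := by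
  have h := (hasDerivAt_iff_isLittleO_nhds_zero.1 (hasDerivAt_primitiveF hf a)).tendsto_div_nhds_zero
  exact h.comp hd

/-- Multiplication by the weight `1 + |u|` is bounded from `H¹` to `L²`. -/
theorem exists_weighted_bound (u : H1rad) : ∃ M : ℝ, 0 ≤ M ∧ ∀ v : H1rad,
    MemLp (fun x => (1 + |u.fn x|) * v.fn x) 2 volume ∧
    √(∫ x, ((1 + |u.fn x|) * v.fn x) ^ 2) ≤ M * ‖v‖ := by
  obtain ⟨K, hK0, hK⟩ := H1rad.exists_sqrt_integral_sq_mul_sq_le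
  refine ⟨√(2 + 2 * (K * ‖u‖) ^ 2), Real.sqrt_nonneg _, fun v => ?_⟩
  have hmem : MemLp (fun x => (1 + |u.fn x|) * v.fn x) 2 volume := by
    have h1 : MemLp (fun x => |u.fn x| * v.fn x) 2 volume :=
      (u.memLp_fn_mul v).congr_norm (u.aesm_fn.norm.mul v.aesm_fn)
        (Eventually.of_forall fun x => by simp)
    refine (v.memLp_fn.add h1).congr_norm ((v.memLp_fn.add h1).1.congr ?_) ?_ <;>
    exact Eventually.of_forall fun x => by simp [add_mul]
  refine ⟨hmem, Real.sqrt_le_iff.2 ⟨by positivity, ?_⟩⟩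
  have h2 : ∫ x, (u.fn x * v.fn x) ^ 2 ≤ (K * ‖u‖) ^ 2 * ‖v‖ ^ 2 := by
    have := (Real.sqrt_le_iff.1 (hK u v)).2
    calc _ ≤ _ := this
      _ = _ := by ring
  have hi : Integrable (fun x => (u.fn x * v.fn x) ^ 2) := (u.memLp_fn_mul v).integrable_sq
  rw [mul_pow, Real.sq_sqrt (by positivity)]
  calc ∫ x, ((1 + |u.fn x|) * v.fn x) ^ 2
      ≤ ∫ x, (2 * v.fn x ^ 2 + 2 * (u.fn x * v.fn x) ^ 2) := by
        refine integral_mono hmem.integrable_sq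
          ((v.integrable_fn_sq.const_mul 2).add (hi.const_mul 2)) fun x => ?_
        have : (1 + |u.fn x|) ^ 2 ≤ 2 + 2 * u.fn x ^ 2 := by
          nlinarith [sq_abs (u.fn x), sq_nonneg (1 - |u.fn x|)]
        have := mul_le_mul_of_nonneg_right this (sq_nonneg (v.fn x))
        simp only [mul_pow] at this ⊢
        linarith
    _ = (2 * ∫ x, v.fn x ^ 2) + 2 * ∫ x, (u.fn x * v.fn x) ^ 2 := by
        rw [integral_add (v.integrable_fn_sq.const_mul 2) (hi.const_mul 2), integral_const_mul,
          integral_const_mul]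
    _ ≤ 2 * ‖v‖ ^ 2 + 2 * ((K * ‖u‖) ^ 2 * ‖v‖ ^ 2) := by
        gcongr
        exact v.integral_fn_sq_le
    _ = _ := by ring

/-- Fréchet differentiability of `u ↦ ∫ F(u)`. The remainder quotient is truncated at a multiple of
`|u| + |u|³`; the truncated part, divided by the weight `1 + |u|`, tends to `0` in `L²`, and the
rest is of higher order. -/
theorem hasFDerivAt_integral_primitiveF (hf : Continuous f)
    (hfb : ∀ t, |f t| ≤ C * (|t| + |t| ^ 3)) (hC : 0 ≤ C) (u : H1rad) {D : H1rad →L[ℝ] ℝ}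
    (hD : ∀ v, D v = ∫ x, f (u.fn x) * v.fn x) :
    HasFDerivAt (fun w : H1rad => ∫ x, primitiveF f (w.fn x)) D u := by
  refine hasFDerivAt_iff_tendsto.2 ?_
  refine tendsto_of_seq_tendsto fun w₀ hw₀ => tendsto_of_subseq_tendsto fun ns hns => ?_
  obtain ⟨ms, hms, hae⟩ := H1rad.exists_subseq_ae (hw₀.comp hns)
  refine ⟨ms, ?_⟩
  let w : ℕ → H1rad := fun k => w₀ (ns (ms k))
  have hw : Tendsto w atTop (𝓝 u) := (hw₀.comp hns).comp hms.tendsto_atTop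
  change Tendsto (fun k => ‖w k - u‖⁻¹ * ‖(∫ x, primitiveF f ((w k).fn x)) -
    (∫ x, primitiveF f (u.fn x)) - D (w k - u)‖) atTop (𝓝 0)
  obtain ⟨M, hM0, hM⟩ := exists_weighted_bound u
  obtain ⟨K, hK0, hK⟩ := H1rad.exists_integral_four_bound
  let d : ℕ → E3 → ℝ := fun k x => (w k - u).fn x
  let r : ℕ → E3 → ℝ := fun k x =>
    primitiveF f (u.fn x + d k x) - primitiveF f (u.fn x) - d k x * f (u.fn x)
  let m : ℕ → E3 → ℝ := fun k x =>
    min |r k x / d k x| (5 * C * (|u.fn x| + |u.fn x| ^ 3)) / (1 + |u.fn x|)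
  have hwd : ∀ k, ∀ᵐ x, (w k).fn x = u.fn x + d k x := fun k => by
    filter_upwards [H1rad.fn_sub (w k) u] with x hx
    simp only [d]
    rw [hx, Pi.sub_apply]
    ring
  have hF := continuous_primitiveF hf
  have hdm : ∀ k, AEStronglyMeasurable (d k) volume := fun k => (w k - u).aesm_fn
  have hrm : ∀ k, AEStronglyMeasurable (r k) volume := fun k =>
    ((hF.comp_aestronglyMeasurable (u.aesm_fn.add (hdm k))).sub
      (hF.comp_aestronglyMeasurable u.aesm_fn)).sub
      ((hdm k).mul (hf.comp_aestronglyMeasurable u.aesm_fn))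
  have hmm : ∀ k, AEStronglyMeasurable (m k) volume := fun k => by
    have h1 : AEMeasurable (fun x => |r k x / d k x|) volume :=
      ((hrm k).aemeasurable.div (hdm k).aemeasurable).abs
    have hu := u.aesm_fn.aemeasurable.abs
    have h2 : AEMeasurable (fun x => 5 * C * (|u.fn x| + |u.fn x| ^ 3)) volume :=
      (hu.add (hu.pow_const 3)).const_mul _
    exact ((h1.min h2).div (hu.const_add 1)).aestronglyMeasurable
  have hm0 : ∀ k x, 0 ≤ m k x := fun k x => by
    have : 0 ≤ 5 * C * (|u.fn x| + |u.fn x| ^ 3) := by positivity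
    exact div_nonneg (le_min (abs_nonneg _) this) (by positivity)
  have hmle : ∀ k x, m k x ^ 2 ≤ (5 * C) ^ 2 * (2 * (u.fn x ^ 2 + u.fn x ^ 4)) := fun k x => by
    have ha := abs_nonneg (u.fn x)
    have h1 : m k x ≤ 5 * C * (|u.fn x| * (1 + |u.fn x|)) := by
      rw [div_le_iff₀ (by positivity)]
      refine (min_le_right _ _).trans ?_
      rw [mul_assoc (5 * C)]
      gcongr
      nlinarith [sq_nonneg (|u.fn x|)]
    refine (pow_le_pow_left₀ (hm0 k x) h1 2).trans ?_
    rw [mul_pow]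
    gcongr
    have e : u.fn x ^ 4 = |u.fn x| ^ 4 := (Even.pow_abs (by decide) _).symm
    rw [e, ← sq_abs (u.fn x)]
    nlinarith [mul_nonneg (sq_nonneg (|u.fn x|)) (sq_nonneg (1 - |u.fn x|))]
  have hbi : Integrable (fun x => (5 * C) ^ 2 * (2 * (u.fn x ^ 2 + u.fn x ^ 4))) :=
    ((u.integrable_fn_sq.add u.integrable_fn_four).const_mul 2).const_mul _
  have hm2 : ∀ k, MemLp (m k) 2 volume := fun k =>
    (memLp_two_iff_integrable_sq (hmm k)).2 (hbi.mono' ((hmm k).pow 2)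
      (Eventually.of_forall fun x => by
        rw [Real.norm_of_nonneg (by positivity)]; exact hmle k x))
  have hmlim : Tendsto (fun k => ∫ x, m k x ^ 2) atTop (𝓝 0) := by
    have := tendsto_integral_of_dominated_convergence (f := fun _ => (0 : ℝ))
      (F := fun k x => m k x ^ 2) _ (fun k => (hmm k).pow 2) hbi
      (fun k => Eventually.of_forall fun x => by
        rw [Real.norm_of_nonneg (by positivity)]; exact hmle k x) ?_
    · simpa using this
    · filter_upwards [hae, ae_all_iff.2 hwd] with x hx hd
      have hd0 : Tendsto (fun k => d k x) atTop (𝓝 0) := by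
        have h1 : Tendsto (fun k => (w k).fn x - u.fn x) atTop (𝓝 (u.fn x - u.fn x)) :=
          hx.sub_const _
        rw [sub_self] at h1
        exact h1.congr fun k => by rw [hd k]; ring
      have h2 := (tendsto_remainder_div hf (u.fn x) hd0).abs
      rw [abs_zero] at h2
      have h3 : Tendsto (fun k => m k x) atTop (𝓝 0) := by
        refine squeeze_zero (fun k => hm0 k x) (fun k => ?_) h2
        refine (div_le_self (le_min (abs_nonneg _) (by positivity))
          (by linarith [abs_nonneg (u.fn x)])).trans (min_le_left _ _)
      simpa using h3.pow 2
  have hkey : ∀ k x, |r k x| ≤ |m k x| * |(1 + |u.fn x|) * d k x| +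
      4 * C * (d k x ^ 2 + d k x ^ 4) := by
    intro k x
    have h1 : |r k x| = |r k x / d k x| * |d k x| := by
      rcases eq_or_ne (d k x) 0 with h0 | h0
      · simp [r, h0]
      · rw [abs_div, div_mul_cancel₀ _ (abs_ne_zero.2 h0)]
    have h2 := abs_remainder_div_le hf hfb hC (u.fn x) (d k x)
    have h3 : |r k x / d k x| ≤ m k x * (1 + |u.fn x|) + 4 * C * (|d k x| + |d k x| ^ 3) := by
      have h5 : 0 ≤ 5 * C * (|u.fn x| + |u.fn x| ^ 3) := by positivity
      have h6 : 0 ≤ 4 * C * (|d k x| + |d k x| ^ 3) := by positivity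
      simp only [m]
      rw [div_mul_cancel₀ _ (by positivity)]
      rcases le_total |r k x / d k x| (5 * C * (|u.fn x| + |u.fn x| ^ 3)) with h | h
      · rw [min_eq_left h]; linarith
      · rw [min_eq_right h]; exact h2
    have e : d k x ^ 4 = |d k x| ^ 4 := (Even.pow_abs (by decide) _).symm
    rw [h1, abs_of_nonneg (hm0 k x), abs_mul, abs_of_pos (by positivity : 0 < 1 + |u.fn x|), e,
      ← sq_abs (d k x)]
    refine (mul_le_mul_of_nonneg_right h3 (abs_nonneg (d k x))).trans (le_of_eq ?_)
    ring
  have hbound : ∀ k, ‖w k - u‖⁻¹ * ‖(∫ x, primitiveF f ((w k).fn x)) -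
      (∫ x, primitiveF f (u.fn x)) - D (w k - u)‖ ≤
      √(∫ x, m k x ^ 2) * M + 4 * C * (‖w k - u‖ + K * ‖w k - u‖ ^ 3) := by
    intro k
    set h := ‖w k - u‖
    have hh0 : 0 ≤ h := norm_nonneg _
    have hR : (∫ x, primitiveF f ((w k).fn x)) - (∫ x, primitiveF f (u.fn x)) - D (w k - u) =
        ∫ x, r k x := by
      have hi : Integrable (fun x => primitiveF f ((w k).fn x) - primitiveF f (u.fn x)) :=
        (integrable_primitiveF hf hfb hC _).sub (integrable_primitiveF hf hfb hC _)
      rw [hD, ← integral_sub (integrable_primitiveF hf hfb hC _)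
        (integrable_primitiveF hf hfb hC _), ← integral_sub hi
        (integrable_nonlinearity hf hfb hC _ _)]
      refine integral_congr_ae ((hwd k).mono fun x hx => ?_)
      simp only [r]
      rw [hx, mul_comm (d k x)]
    have hi1 : Integrable (fun x => |m k x| * |(1 + |u.fn x|) * d k x|) :=
      MemLp.integrable_mul (p := 2) (q := 2) (hm2 k).abs (hM (w k - u)).1.abs
    have hi2 : Integrable (fun x => 4 * C * (d k x ^ 2 + d k x ^ 4)) :=
      ((w k - u).integrable_fn_sq.add (w k - u).integrable_fn_four).const_mul _
    have h1 : ‖∫ x, r k x‖ ≤ √(∫ x, m k x ^ 2) * (M * h) + 4 * C * (h ^ 2 + K * h ^ 4) := by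
      calc ‖∫ x, r k x‖ ≤ ∫ x, |r k x| := norm_integral_le_integral_norm _
        _ ≤ ∫ x, (|m k x| * |(1 + |u.fn x|) * d k x| + 4 * C * (d k x ^ 2 + d k x ^ 4)) :=
            integral_mono_of_nonneg (Eventually.of_forall fun x => abs_nonneg _) (hi1.add hi2)
              (Eventually.of_forall (hkey k))
        _ = (∫ x, |m k x| * |(1 + |u.fn x|) * d k x|) +
            4 * C * ((∫ x, d k x ^ 2) + ∫ x, d k x ^ 4) := by
            rw [integral_add hi1 hi2, integral_const_mul, integral_add
              (w k - u).integrable_fn_sq (w k - u).integrable_fn_four]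
        _ ≤ _ := by
            gcongr
            · refine (integral_abs_mul_le (hm2 k) (hM (w k - u)).1).trans ?_
              gcongr
              exact (hM (w k - u)).2
            · exact (w k - u).integral_fn_sq_le
            · exact hK (w k - u)
    rw [hR]
    rcases hh0.eq_or_lt with h0 | h0
    · rw [← h0]
      simp only [inv_zero, zero_mul]
      positivity
    · rw [inv_mul_le_iff₀ h0]
      refine h1.trans (le_of_eq ?_)
      ring
  have hh := tendsto_iff_norm_sub_tendsto_zero.1 hw
  refine squeeze_zero (fun k => by positivity) hbound ?_
  have h1 := hmlim.sqrt.mul_const M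
  have h2 := (hh.add ((hh.pow 3).const_mul K)).const_mul (4 * C)
  simpa using h1.add h2

end Nonlinearity

/-! ### Minimisation under two sign conditions -/

/-- Let `u = p - n` minimise `I` over the `w` with `I'(w)[P w] = I'(w)[P(-w)] = 0`, where `P` is
a continuous map playing the role of the positive part. If the derivatives of `I` along the family
`s p - t n` have the signs of a maximum at `(1, 1)`, then `I'(u) = 0`. Otherwise `I'(u) v < 0` for
some `v`; by the Poincaré–Miranda theorem the perturbed family `s p - t n + e v` still meets the
constraints, at a point of lower energy. -/
theorem fderiv_eq_zero_of_nodal_minimizer {H : Type*} [NormedAddCommGroup H] [NormedSpace ℝ H]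
    {I : H → ℝ} {D : H → H →L[ℝ] ℝ} (hI : ∀ w, HasFDerivAt I (D w) w)
    (hD : Continuous fun z : H × H => D z.1 z.2) {P : H → H} (hP : Continuous P) {p n : H}
    (hp : P (p - n) ≠ 0) (hn : P (-(p - n)) ≠ 0)
    (hl : ∀ s t : ℝ, 0 < s → s < 1 → s ≤ t → 0 < D (s • p - t • n) (P (s • p - t • n)))
    (hr : ∀ s t : ℝ, 1 < s → 0 < t → t ≤ s → D (s • p - t • n) (P (s • p - t • n)) < 0)
    (hb : ∀ s t : ℝ, 0 < t → t < 1 → t ≤ s → D (s • p - t • n) (P (-(s • p - t • n))) < 0)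
    (ht : ∀ s t : ℝ, 1 < t → 0 < s → s ≤ t → 0 < D (s • p - t • n) (P (-(s • p - t • n))))
    (hle : ∀ s t : ℝ, 0 < s → 0 < t → I (s • p - t • n) ≤ I (p - n))
    (hmin : ∀ w, P w ≠ 0 → P (-w) ≠ 0 → D w (P w) = 0 → D w (P (-w)) = 0 → I (p - n) ≤ I w) :
    D (p - n) = 0 := by
  by_contra hne
  obtain ⟨v, hv⟩ : ∃ v, D (p - n) v < 0 := by
    obtain ⟨v, hv⟩ := DFunLike.ne_iff.1 hne
    rcases lt_or_gt_of_ne hv with h | h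
    · exact ⟨v, h⟩
    · exact ⟨-v, by rw [map_neg]; simpa using h⟩
  let W : ℝ × ℝ × ℝ → H := fun z => z.1 • p - z.2.1 • n + z.2.2 • v
  have hW : Continuous W := by fun_prop
  have hDv : Continuous fun w => D w v := hD.comp (continuous_id.prodMk continuous_const)
  have hPn : Continuous fun w => P (-w) := hP.comp continuous_neg
  obtain ⟨r, hr0, hball⟩ : ∃ r > 0, ∀ s t e : ℝ, |s - 1| < r → |t - 1| < r → |e| < r →
      P (W (s, t, e)) ≠ 0 ∧ P (-W (s, t, e)) ≠ 0 ∧ D (W (s, t, e)) v < 0 := by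
    have hopen : IsOpen {z | P (W z) ≠ 0 ∧ P (-W z) ≠ 0 ∧ D (W z) v < 0} :=
      (isOpen_ne_fun (hP.comp hW) continuous_const).inter
        ((isOpen_ne_fun (hPn.comp hW) continuous_const).inter
          (isOpen_lt (hDv.comp hW) continuous_const))
    have hmem : ((1, 1, 0) : ℝ × ℝ × ℝ) ∈ {z | P (W z) ≠ 0 ∧ P (-W z) ≠ 0 ∧ D (W z) v < 0} := by
      have : W (1, 1, 0) = p - n := by simp [W]
      rw [mem_ofPred_eq, this]
      exact ⟨hp, hn, hv⟩
    obtain ⟨r, hr0, hsub⟩ := Metric.isOpen_iff.1 hopen _ hmem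
    refine ⟨r, hr0, fun s t e h1 h2 h3 => hsub ?_⟩
    rw [Metric.mem_ball, Prod.dist_eq, Prod.dist_eq]
    simp only [Real.dist_eq, sub_zero]
    exact max_lt h1 (max_lt h2 h3)
  obtain ⟨δ, hδ0, hδ1, hδr⟩ : ∃ δ : ℝ, 0 < δ ∧ δ < 1 ∧ δ < r :=
    ⟨min r 1 / 2, by positivity, by linarith [min_le_right r 1, min_le_left r 1],
      by linarith [min_le_right r 1, min_le_left r 1]⟩
  let G₁ : ℝ → ℝ → ℝ → ℝ := fun e s t => D (W (s, t, e)) (P (W (s, t, e)))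
  let G₂ : ℝ → ℝ → ℝ → ℝ := fun e s t => -D (W (s, t, e)) (P (-W (s, t, e)))
  have hG₁ : Continuous fun z : ℝ × ℝ × ℝ => G₁ z.1 z.2.1 z.2.2 :=
    (hD.comp (continuous_id.prodMk hP)).comp
      (hW.comp (by fun_prop : Continuous fun z : ℝ × ℝ × ℝ => (z.2.1, z.2.2, z.1)))
  have hG₂ : Continuous fun z : ℝ × ℝ × ℝ => G₂ z.1 z.2.1 z.2.2 :=
    ((hD.comp (continuous_id.prodMk hPn)).comp
      (hW.comp (by fun_prop : Continuous fun z : ℝ × ℝ × ℝ => (z.2.1, z.2.2, z.1)))).neg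
  have hW0 : ∀ s t : ℝ, W (s, t, 0) = s • p - t • n := fun s t => by simp [W]
  -- strict inequalities on a compact side persist for small perturbations
  have persist : ∀ g : ℝ → ℝ → ℝ, (Continuous fun z : ℝ × ℝ => g z.1 z.2) →
      (∀ y ∈ Icc (1 - δ) (1 + δ), 0 < g 0 y) →
      ∀ᶠ e in 𝓝 (0 : ℝ), ∀ y ∈ Icc (1 - δ) (1 + δ), 0 < g e y := fun g hg h0 =>
    isCompact_Icc.eventually_forall_of_forall_eventually fun y hy =>
      hg.continuousAt.eventually (lt_mem_nhds (h0 y hy))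
  have e1 := persist (fun e t => G₁ e (1 - δ) t) (hG₁.comp (by fun_prop :
    Continuous fun z : ℝ × ℝ => (z.1, 1 - δ, z.2))) fun t h => by
      simp only [G₁, hW0]; exact hl _ _ (by linarith) (by linarith) h.1
  have e2 := persist (fun e t => -G₁ e (1 + δ) t) (hG₁.comp (by fun_prop :
    Continuous fun z : ℝ × ℝ => (z.1, 1 + δ, z.2))).neg fun t h => by
      simp only [G₁, hW0]; exact neg_pos.2 (hr _ _ (by linarith) (by linarith [h.1]) h.2)
  have e3 := persist (fun e s => G₂ e s (1 - δ)) (hG₂.comp (by fun_prop :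
    Continuous fun z : ℝ × ℝ => (z.1, z.2, 1 - δ))) fun s h => by
      simp only [G₂, hW0]; exact neg_pos.2 (hb _ _ (by linarith) (by linarith) h.1)
  have e4 := persist (fun e s => -G₂ e s (1 + δ)) (hG₂.comp (by fun_prop :
    Continuous fun z : ℝ × ℝ => (z.1, z.2, 1 + δ))).neg fun s h => by
      simp only [G₂, hW0, neg_neg]; exact ht _ _ (by linarith) (by linarith [h.1]) h.2
  have hev : ∀ᶠ e in 𝓝[>] (0 : ℝ), _ := nhdsWithin_le_nhds (e1.and (e2.and (e3.and e4)))
  obtain ⟨e, ⟨h1, h2, h3, h4⟩, he0, heδ⟩ :=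
    (hev.and (Ioo_mem_nhdsGT hδ0)).exists
  obtain ⟨s, hs, t, ht', hz1, hz2⟩ := poincare_miranda (a := 1 - δ) (b := 1 + δ) (by linarith)
    (g₁ := G₁ e) (g₂ := G₂ e)
    (hG₁.comp (by fun_prop : Continuous fun z : ℝ × ℝ => (e, z.1, z.2)))
    (hG₂.comp (by fun_prop : Continuous fun z : ℝ × ℝ => (e, z.1, z.2)))
    h1 (fun t h => neg_pos.1 (h2 t h)) h3 (fun s h => neg_pos.1 (h4 s h))
  have hsr : |s - 1| < r := (abs_le.2 ⟨by linarith [hs.1], by linarith [hs.2]⟩).trans_lt hδr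
  have htr : |t - 1| < r := (abs_le.2 ⟨by linarith [ht'.1], by linarith [ht'.2]⟩).trans_lt hδr
  obtain ⟨k1, k2, -⟩ := hball s t e hsr htr (by rw [abs_of_pos he0]; linarith)
  have hge := hmin _ k1 k2 hz1 (neg_eq_zero.1 hz2)
  have hder : ∀ θ : ℝ, HasDerivAt (fun θ => I (W (s, t, θ))) (D (W (s, t, θ)) v) θ := by
    intro θ
    have hlin : HasDerivAt (fun θ : ℝ => W (s, t, θ)) v θ := by
      simpa [W] using ((hasDerivAt_id θ).smul_const v).const_add (s • p - t • n)
    exact (hI _).comp_hasDerivAt θ hlin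
  obtain ⟨θ, hθ, hslope⟩ := exists_hasDerivAt_eq_slope (fun θ => I (W (s, t, θ)))
    (fun θ => D (W (s, t, θ)) v) he0 (fun θ _ => (hder θ).continuousAt.continuousWithinAt)
    (fun θ _ => hder θ)
  have hneg := (hball s t θ hsr htr (by rw [abs_of_pos hθ.1]; linarith [hθ.2])).2.2
  rw [hslope, sub_zero, div_neg_iff] at hneg
  have h5 : I (W (s, t, e)) < I (W (s, t, 0)) := by
    rcases hneg with h | h
    · linarith [h.2]
    · linarith [h.1]
  have h6 := hle s t (by linarith [hs.1]) (by linarith [ht'.1])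
  rw [hW0] at h5
  linarith

/-! ### The derivative of the energy -/

/-- The derivative `I'(w)[v]`. -/
noncomputable def energyDeriv (f : ℝ → ℝ) (lam : ℝ) (w v : H1rad) : ℝ :=
  inner ℝ w v + lam * coulombForm w w w v - ∫ x, f (w.fn x) * v.fn x

theorem energy_eq (f : ℝ → ℝ) (lam : ℝ) (u : H1rad) :
    energy f lam u = 1 / 2 * ‖u‖ ^ 2 + lam / 4 * coulombForm u u u u -
      ∫ x, primitiveF f (u.fn x) := by
  rw [energy, ← H1rad.norm_sq_eq, integral_poissonPotential]

section Energy

variable {f : ℝ → ℝ} {C : ℝ}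

theorem exists_hasFDerivAt_energy (lam : ℝ) (hf : Continuous f)
    (hfb : ∀ t, |f t| ≤ C * (|t| + |t| ^ 3)) (hC : 0 ≤ C) (w : H1rad) :
    ∃ D : H1rad →L[ℝ] ℝ, HasFDerivAt (energy f lam) D w ∧ ∀ v, D v = energyDeriv f lam w v := by
  obtain ⟨N, hN⟩ := exists_nonlinearityCLM hf hfb hC w
  obtain ⟨Q, hQ, hQv⟩ := isQuarticForm_coulombForm.exists_hasFDerivAt w
  have h1 : HasFDerivAt (fun u : H1rad => ‖u‖ ^ 2) (2 • innerSL ℝ w) w :=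
    (hasStrictFDerivAt_norm_sq w).hasFDerivAt
  have h2 := hasFDerivAt_integral_primitiveF hf hfb hC w hN
  have h3 := ((h1.const_mul (1 / 2)).add (hQ.const_mul (lam / 4))).sub h2
  refine ⟨_, h3.congr_of_eventuallyEq (Eventually.of_forall (energy_eq f lam)), fun v => ?_⟩
  have e : (2 • innerSL ℝ w : H1rad →L[ℝ] ℝ) v = 2 * inner ℝ w v := by
    rw [two_smul, two_mul]; rfl
  change 1 / 2 * (2 • innerSL ℝ w : H1rad →L[ℝ] ℝ) v + lam / 4 * Q v - N v = _
  rw [e, hQv, hN, energyDeriv]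
  ring

theorem continuous_energyDeriv (lam : ℝ) (hf : Continuous f)
    (hfb : ∀ t, |f t| ≤ C * (|t| + |t| ^ 3)) (hC : 0 ≤ C) :
    Continuous fun z : H1rad × H1rad => energyDeriv f lam z.1 z.2 :=
  ((continuous_fst.inner continuous_snd).add
    (isQuarticForm_coulombForm.continuous_cubic.const_mul lam)).sub
    (continuous_nonlinearity hf hfb hC)

theorem energyDeriv_neg (lam : ℝ) (hodd : ∀ t : ℝ, f t = -f (-t)) (w v : H1rad) :
    energyDeriv f lam (-w) v = -energyDeriv f lam w v := by
  have h1 : ∫ x, f ((-w).fn x) * v.fn x = -∫ x, f (w.fn x) * v.fn x := by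
    rw [← integral_neg]
    refine integral_congr_ae ?_
    filter_upwards [H1rad.fn_neg w] with x hx
    rw [hx, Pi.neg_apply, hodd (-w.fn x), neg_neg, neg_mul]
  have h2 : inner ℝ (-w) v = -inner ℝ w v := inner_neg_left w v
  rw [energyDeriv, energyDeriv, h1, h2, isQuarticForm_coulombForm.neg_cubic]
  ring

end Energy

/-! ### Energy and derivative of `s u⁺ + t u⁻` -/

section Family

variable {H : Type*} [NormedAddCommGroup H] [InnerProductSpace ℝ H]

theorem inner_smul_sub_smul_left {p n : H} (h : inner ℝ p n = 0) (s t : ℝ) :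
    inner ℝ (s • p - t • n) p = s * ‖p‖ ^ 2 := by
  rw [inner_sub_left, real_inner_smul_left, real_inner_smul_left, real_inner_comm p n, h,
    real_inner_self_eq_norm_sq]
  ring

theorem norm_smul_sub_smul_sq {p n : H} (h : inner ℝ p n = 0) (s t : ℝ) :
    ‖s • p - t • n‖ ^ 2 = s ^ 2 * ‖p‖ ^ 2 + t ^ 2 * ‖n‖ ^ 2 := by
  rw [norm_sub_sq_real, real_inner_smul_left, real_inner_smul_right, h, norm_smul, norm_smul,
    mul_pow, mul_pow, Real.norm_eq_abs, Real.norm_eq_abs, sq_abs, sq_abs]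
  ring

end Family

/-- `p` and `n` are the positive part and the absolute value of the negative part of `p - n`. Their
orthogonality in `H¹` follows from the other conditions; it is recorded here as a field. -/
structure IsDisjointPair (p n : H1rad) : Prop where
  left_nonneg : ∀ᵐ x, 0 ≤ p.fn x
  right_nonneg : ∀ᵐ x, 0 ≤ n.fn x
  mul_eq_zero : ∀ᵐ x, p.fn x * n.fn x = 0
  inner_eq_zero : inner ℝ p n = 0

namespace IsDisjointPair

variable {p n : H1rad}

theorem symm (h : IsDisjointPair p n) : IsDisjointPair n p :=
  ⟨h.right_nonneg, h.left_nonneg, h.mul_eq_zero.mono fun x hx => by rw [mul_comm, hx],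
    (real_inner_comm p n).trans h.inner_eq_zero⟩

theorem _root_.H1rad.isDisjointPair (u : H1rad) : IsDisjointPair u.pos (-u).pos := by
  refine ⟨u.fn_pos.mono fun x hx => by rw [hx]; exact le_max_right _ _,
    (-u).fn_pos.mono fun x hx => by rw [hx]; exact le_max_right _ _, ?_, u.inner_pos_pos_neg⟩
  filter_upwards [u.fn_pos, (-u).fn_pos, H1rad.fn_neg u] with x h1 h2 h3
  rw [h1, h2, h3, Pi.neg_apply]
  rcases le_total (u.fn x) 0 with h | h
  · rw [max_eq_right h, zero_mul]
  · rw [max_eq_right (by linarith : -u.fn x ≤ 0), mul_zero]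

theorem fn_family (p n : H1rad) (s t : ℝ) :
    ∀ᵐ x, (s • p - t • n).fn x = s * p.fn x - t * n.fn x := by
  filter_upwards [H1rad.fn_sub (s • p) (t • n), H1rad.fn_smul s p, H1rad.fn_smul t n]
    with x h1 h2 h3
  rw [h1, Pi.sub_apply, h2, h3]
  rfl

theorem pos_family (h : IsDisjointPair p n) {s t : ℝ} (hs : 0 ≤ s) (ht : 0 ≤ t) :
    (s • p - t • n).pos = s • p := by
  refine H1rad.ext_fn ?_
  filter_upwards [(s • p - t • n).fn_pos, fn_family p n s t, H1rad.fn_smul s p, h.left_nonneg,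
    h.right_nonneg, h.mul_eq_zero] with x h1 h2 h3 h4 h5 h6
  rw [h1, h2, h3, Pi.smul_apply, smul_eq_mul]
  rcases _root_.mul_eq_zero.1 h6 with h0 | h0
  · rw [h0, mul_zero, zero_sub, max_eq_right]
    exact neg_nonpos.2 (mul_nonneg ht h5)
  · rw [h0, mul_zero, sub_zero, max_eq_left (mul_nonneg hs h4)]

variable {f : ℝ → ℝ} {lam : ℝ}

theorem energyDeriv_family (h : IsDisjointPair p n) (s t : ℝ) :
    energyDeriv f lam (s • p - t • n) p = s * ‖p‖ ^ 2 +
      lam * (s ^ 3 * coulombForm p p p p + s * t ^ 2 * coulombForm p p n n) -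
      ∫ x, f (s * p.fn x) * p.fn x := by
  have h1 : inner ℝ (s • p - t • n) p = s * ‖p‖ ^ 2 :=
    inner_smul_sub_smul_left h.inner_eq_zero s t
  have h2 : ∫ x, f ((s • p - t • n).fn x) * p.fn x = ∫ x, f (s * p.fn x) * p.fn x := by
    refine integral_congr_ae ?_
    filter_upwards [fn_family p n s t, h.mul_eq_zero] with x h1 h6
    rw [h1]
    rcases _root_.mul_eq_zero.1 h6 with h0 | h0
    · simp [h0]
    · simp [h0]
  rw [energyDeriv, h1, h2, (isQuarticForm_coulombForm.expand
    (coulombForm_eq_zero_of_mul_eq_zero h.mul_eq_zero) s t).2]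

theorem energy_family (h : IsDisjointPair p n) (hodd : ∀ t : ℝ, f t = -f (-t)) (s t : ℝ)
    (hp : Integrable fun x => primitiveF f (s * p.fn x))
    (hn : Integrable fun x => primitiveF f (t * n.fn x)) :
    energy f lam (s • p - t • n) = 1 / 2 * (s ^ 2 * ‖p‖ ^ 2 + t ^ 2 * ‖n‖ ^ 2) +
      lam / 4 * (s ^ 4 * coulombForm p p p p + 2 * s ^ 2 * t ^ 2 * coulombForm p p n n +
        t ^ 4 * coulombForm n n n n) -
      ((∫ x, primitiveF f (s * p.fn x)) + ∫ x, primitiveF f (t * n.fn x)) := by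
  have h1 : ‖s • p - t • n‖ ^ 2 = s ^ 2 * ‖p‖ ^ 2 + t ^ 2 * ‖n‖ ^ 2 :=
    norm_smul_sub_smul_sq h.inner_eq_zero s t
  have h2 : ∫ x, primitiveF f ((s • p - t • n).fn x) =
      (∫ x, primitiveF f (s * p.fn x)) + ∫ x, primitiveF f (t * n.fn x) := by
    rw [← integral_add hp hn]
    refine integral_congr_ae ?_
    filter_upwards [fn_family p n s t, h.mul_eq_zero] with x h1 h6
    have hF0 : primitiveF f 0 = 0 := by simp [primitiveF]
    rw [h1]
    rcases _root_.mul_eq_zero.1 h6 with h0 | h0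
    · rw [h0, mul_zero, zero_sub, hF0, zero_add, primitiveF_neg hodd]
    · rw [h0, mul_zero, sub_zero, hF0, add_zero]
  rw [energy_eq, h1, h2, (isQuarticForm_coulombForm.expand
    (coulombForm_eq_zero_of_mul_eq_zero h.mul_eq_zero) s t).1]

end IsDisjointPair

/-! ### Consequences of the monotonicity of `f(t) / t³` -/

section Monotonicity

variable {f : ℝ → ℝ}

theorem mul_cube_le_of_ratio_mono (h5 : StrictMonoOn (fun t : ℝ => f t / t ^ 3) (Ioi 0)) {a b : ℝ}
    (ha : 0 < a) (hab : a ≤ b) : f a * b ^ 3 ≤ f b * a ^ 3 := by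
  have hb : 0 < b := ha.trans_le hab
  have := h5.monotoneOn ha hb hab
  rwa [div_le_div_iff₀ (by positivity) (by positivity)] at this

theorem scaled_mul_le (h5 : StrictMonoOn (fun t : ℝ => f t / t ^ 3) (Ioi 0)) {s τ : ℝ}
    (hs : 0 < s) (hs1 : s ≤ 1) (hτ : 0 ≤ τ) : f (s * τ) * τ ≤ s ^ 3 * (f τ * τ) := by
  rcases hτ.eq_or_lt with rfl | hτ
  · simp
  have h := mul_cube_le_of_ratio_mono h5 (mul_pos hs hτ) (mul_le_of_le_one_left hτ.le hs1)
  have h3 : 0 < τ ^ 3 := by positivity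
  have h4 : f (s * τ) ≤ s ^ 3 * f τ := by
    rw [mul_pow] at h
    exact le_of_mul_le_mul_right (by linarith) h3
  calc f (s * τ) * τ ≤ s ^ 3 * f τ * τ := by gcongr
    _ = _ := by ring

theorem le_scaled_mul (h5 : StrictMonoOn (fun t : ℝ => f t / t ^ 3) (Ioi 0)) {s τ : ℝ}
    (hs1 : 1 ≤ s) (hτ : 0 ≤ τ) : s ^ 3 * (f τ * τ) ≤ f (s * τ) * τ := by
  rcases hτ.eq_or_lt with rfl | hτ
  · simp
  have h := mul_cube_le_of_ratio_mono h5 hτ (le_mul_of_one_le_left hτ.le hs1)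
  have h3 : 0 < τ ^ 3 := by positivity
  have h4 : s ^ 3 * f τ ≤ f (s * τ) := by
    rw [mul_pow] at h
    exact le_of_mul_le_mul_right (by linarith) h3
  calc s ^ 3 * (f τ * τ) = s ^ 3 * f τ * τ := by ring
    _ ≤ _ := by gcongr

/-- The function `s ↦ F(sτ) + (1 - s⁴) / 4 f(τ) τ` has its minimum at `s = 1`. -/
theorem primitiveF_le_scaled (hf : Continuous f)
    (h5 : StrictMonoOn (fun t : ℝ => f t / t ^ 3) (Ioi 0)) {s τ : ℝ} (hs : 0 < s) (hτ : 0 ≤ τ) :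
    primitiveF f τ ≤ primitiveF f (s * τ) + (1 - s ^ 4) / 4 * (f τ * τ) := by
  let h : ℝ → ℝ := fun s => primitiveF f (s * τ) + (1 - s ^ 4) / 4 * (f τ * τ)
  have hd : ∀ s, HasDerivAt h (f (s * τ) * τ - s ^ 3 * (f τ * τ)) s := by
    intro s
    have h1 : HasDerivAt (fun s : ℝ => s * τ) τ s := by
      simpa using (hasDerivAt_id s).mul_const τ
    have h2 := (hasDerivAt_primitiveF hf (s * τ)).comp s h1
    have h3 := ((((hasDerivAt_pow 4 s).const_sub 1).div_const 4).mul_const (f τ * τ))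
    refine (h2.add h3).congr_deriv ?_
    norm_num
    ring
  have hc : Continuous h := continuous_iff_continuousAt.2 fun s => (hd s).continuousAt
  have h1 : h 1 = primitiveF f τ := by simp [h]
  rw [← h1]
  change h 1 ≤ h s
  rcases lt_trichotomy s 1 with hlt | rfl | hgt
  · obtain ⟨ξ, hξ, he⟩ := exists_hasDerivAt_eq_slope h _ hlt hc.continuousOn fun x _ => hd x
    have := scaled_mul_le h5 (hs.trans hξ.1) hξ.2.le hτ
    have h2 : (h 1 - h s) / (1 - s) ≤ 0 := by rw [← he]; linarith
    rw [div_le_iff₀ (by linarith), zero_mul] at h2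
    linarith
  · exact le_rfl
  · obtain ⟨ξ, hξ, he⟩ := exists_hasDerivAt_eq_slope h _ hgt hc.continuousOn fun x _ => hd x
    have := le_scaled_mul h5 hξ.1.le hτ
    have h2 : 0 ≤ (h s - h 1) / (s - 1) := by rw [← he]; linarith
    rw [le_div_iff₀ (by linarith), zero_mul] at h2
    linarith

end Monotonicity

/-! ### Signs and maximality along `s u⁺ + t u⁻` -/

namespace IsDisjointPair

variable {p n : H1rad} {f : ℝ → ℝ} {lam C : ℝ}

theorem integrable_scaled (hf : Continuous f) (hfb : ∀ t, |f t| ≤ C * (|t| + |t| ^ 3))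
    (hC : 0 ≤ C) (s : ℝ) (p : H1rad) : Integrable fun x => f (s * p.fn x) * p.fn x :=
  (integrable_nonlinearity hf hfb hC (s • p) p).congr
    ((H1rad.fn_smul s p).mono fun x hx => by simp only [hx, Pi.smul_apply, smul_eq_mul])

theorem integrable_primitiveF_scaled (hf : Continuous f)
    (hfb : ∀ t, |f t| ≤ C * (|t| + |t| ^ 3)) (hC : 0 ≤ C) (s : ℝ) (p : H1rad) :
    Integrable fun x => primitiveF f (s * p.fn x) :=
  (integrable_primitiveF hf hfb hC (s • p)).congr
    ((H1rad.fn_smul s p).mono fun x hx => by simp only [hx, Pi.smul_apply, smul_eq_mul])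

theorem energyDeriv_one (h : IsDisjointPair p n) : energyDeriv f lam (p - n) p =
    ‖p‖ ^ 2 + lam * (coulombForm p p p p + coulombForm p p n n) - ∫ x, f (p.fn x) * p.fn x := by
  have := h.energyDeriv_family (f := f) (lam := lam) 1 1
  simpa using this

/-- Where `s < 1` and `s ≤ t`, the energy of `s p - t n` increases in `s`: by `I'(p - n)[p] = 0` and
the monotonicity of `f(t) / t³` its derivative is at least
`(s - s³) ‖p‖² + lam s (t² - s²) D(p², n²)`, with `D` the Coulomb energy. -/
theorem energyDeriv_pos (h : IsDisjointPair p n) (hlam : 0 < lam) (hf : Continuous f)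
    (hfb : ∀ t, |f t| ≤ C * (|t| + |t| ^ 3)) (hC : 0 ≤ C)
    (h5 : StrictMonoOn (fun t : ℝ => f t / t ^ 3) (Ioi 0)) (hp : p ≠ 0)
    (hz : energyDeriv f lam (p - n) p = 0) {s t : ℝ} (hs : 0 < s) (hs1 : s < 1) (hst : s ≤ t) :
    0 < energyDeriv f lam (s • p - t • n) p := by
  rw [h.energyDeriv_one, sub_eq_zero] at hz
  rw [h.energyDeriv_family]
  have hi : ∫ x, f (s * p.fn x) * p.fn x ≤ s ^ 3 * ∫ x, f (p.fn x) * p.fn x := by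
    rw [← integral_const_mul]
    refine integral_mono_ae (integrable_scaled hf hfb hC s p)
      ((integrable_nonlinearity hf hfb hC p p).const_mul _) ?_
    exact h.left_nonneg.mono fun x hx => scaled_mul_le h5 hs hs1.le hx
  have ha : 0 < ‖p‖ ^ 2 := by have := norm_pos_iff.2 hp; positivity
  have hA := coulombForm_nonneg p n
  have e1 : 0 < (s - s ^ 3) * ‖p‖ ^ 2 := by
    refine mul_pos ?_ ha
    have : s - s ^ 3 = s * ((1 - s) * (1 + s)) := by ring
    rw [this]
    exact mul_pos hs (mul_pos (by linarith) (by linarith))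
  have e2 : 0 ≤ lam * (s * ((t - s) * (t + s)) * coulombForm p p n n) :=
    mul_nonneg hlam.le (mul_nonneg (mul_nonneg hs.le
      (mul_nonneg (by linarith) (by linarith))) hA)
  rw [← hz] at hi
  linear_combination e1 + e2 + hi

theorem energyDeriv_lt_zero (h : IsDisjointPair p n) (hlam : 0 < lam) (hf : Continuous f)
    (hfb : ∀ t, |f t| ≤ C * (|t| + |t| ^ 3)) (hC : 0 ≤ C)
    (h5 : StrictMonoOn (fun t : ℝ => f t / t ^ 3) (Ioi 0)) (hp : p ≠ 0)
    (hz : energyDeriv f lam (p - n) p = 0) {s t : ℝ} (hs1 : 1 < s) (ht : 0 < t) (hts : t ≤ s) :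
    energyDeriv f lam (s • p - t • n) p < 0 := by
  rw [h.energyDeriv_one, sub_eq_zero] at hz
  rw [h.energyDeriv_family]
  have hs : 0 < s := one_pos.trans hs1
  have hi : s ^ 3 * ∫ x, f (p.fn x) * p.fn x ≤ ∫ x, f (s * p.fn x) * p.fn x := by
    rw [← integral_const_mul]
    refine integral_mono_ae ((integrable_nonlinearity hf hfb hC p p).const_mul _)
      (integrable_scaled hf hfb hC s p) ?_
    exact h.left_nonneg.mono fun x hx => le_scaled_mul h5 hs1.le hx
  have ha : 0 < ‖p‖ ^ 2 := by have := norm_pos_iff.2 hp; positivity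
  have hA := coulombForm_nonneg p n
  have e1 : 0 < (s ^ 3 - s) * ‖p‖ ^ 2 := by
    refine mul_pos ?_ ha
    have : s ^ 3 - s = s * ((s - 1) * (1 + s)) := by ring
    rw [this]
    exact mul_pos hs (mul_pos (by linarith) (by linarith))
  have e2 : 0 ≤ lam * (s * ((s - t) * (t + s)) * coulombForm p p n n) :=
    mul_nonneg hlam.le (mul_nonneg (mul_nonneg hs.le
      (mul_nonneg (by linarith) (by linarith))) hA)
  rw [← hz] at hi
  linear_combination e1 + e2 + hi

/-- On the family `s p - t n` the energy is largest at `(1, 1)`: in the difference the quartic terms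
combine to squares, and the local terms are compared by `primitiveF_le_scaled`. -/
theorem energy_family_le (h : IsDisjointPair p n) (hlam : 0 < lam) (hf : Continuous f)
    (hodd : ∀ t : ℝ, f t = -f (-t)) (hfb : ∀ t, |f t| ≤ C * (|t| + |t| ^ 3)) (hC : 0 ≤ C)
    (h5 : StrictMonoOn (fun t : ℝ => f t / t ^ 3) (Ioi 0))
    (hzp : energyDeriv f lam (p - n) p = 0) (hzn : energyDeriv f lam (n - p) n = 0) {s t : ℝ}
    (hs : 0 < s) (ht : 0 < t) : energy f lam (s • p - t • n) ≤ energy f lam (p - n) := by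
  rw [h.energyDeriv_one] at hzp
  rw [h.symm.energyDeriv_one, coulombForm_symm n n p p] at hzn
  have hF : ∀ (s : ℝ), 0 < s → ∀ q : H1rad, (∀ᵐ x, 0 ≤ q.fn x) → ∫ x, primitiveF f (q.fn x) ≤
      (∫ x, primitiveF f (s * q.fn x)) + (1 - s ^ 4) / 4 * ∫ x, f (q.fn x) * q.fn x := by
    intro s hs q hq
    have hi := (integrable_nonlinearity hf hfb hC q q).const_mul ((1 - s ^ 4) / 4)
    rw [← integral_const_mul, ← integral_add (integrable_primitiveF_scaled hf hfb hC s q) hi]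
    exact integral_mono_ae (integrable_primitiveF hf hfb hC q)
      ((integrable_primitiveF_scaled hf hfb hC s q).add hi)
      (hq.mono fun x hx => primitiveF_le_scaled hf h5 hs hx)
  have h1 := h.energy_family (lam := lam) hodd 1 1 (integrable_primitiveF_scaled hf hfb hC 1 p)
    (integrable_primitiveF_scaled hf hfb hC 1 n)
  simp only [one_smul, one_pow, one_mul, mul_one] at h1
  rw [h1, h.energy_family hodd s t (integrable_primitiveF_scaled hf hfb hC s p)
    (integrable_primitiveF_scaled hf hfb hC t n)]
  have hp := hF s hs p h.left_nonneg
  have hn := hF t ht n h.right_nonneg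
  rw [← sub_eq_zero.1 hzp] at hp
  rw [← sub_eq_zero.1 hzn] at hn
  have e1 : 0 ≤ (1 - s ^ 2) ^ 2 * ‖p‖ ^ 2 := by positivity
  have e2 : 0 ≤ (1 - t ^ 2) ^ 2 * ‖n‖ ^ 2 := by positivity
  have e3 : 0 ≤ lam * ((s ^ 2 - t ^ 2) ^ 2 * coulombForm p p n n) :=
    mul_nonneg hlam.le (mul_nonneg (sq_nonneg _) (coulombForm_nonneg p n))
  nlinarith

end IsDisjointPair

/-! ### Minimisers on the nodal Nehari set -/

theorem H1rad.pos_zero : (0 : H1rad).pos = 0 := by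
  refine H1rad.ext_fn ?_
  have h0 : (0 : H1rad).fn =ᵐ[volume] 0 := Lp.coeFn_zero ℝ 2 (volume : Measure E3)
  filter_upwards [(0 : H1rad).fn_pos, h0] with x h1 h2
  rw [h1, h2]
  simp

set_option maxHeartbeats 1000000 in
theorem proposition3p6 (f : ℝ → ℝ) (lam : ℝ) (hlam : 0 < lam)
    (hf1 : Continuous f)
    (hf2 : ∀ t : ℝ, f t = -f (-t))
    (hf3 : Tendsto (fun t : ℝ => f t / t) (𝓝[≠] 0) (𝓝 0))
    (hf4 : Tendsto (fun t : ℝ => f t / t ^ 3) atTop (𝓝 1))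
    (hf4' : ∀ t : ℝ, t ≠ 0 → f t / t ^ 3 < 1)
    (hf5 : StrictMonoOn (fun t : ℝ => f t / t ^ 3) (Ioi 0))
    (hf6 : Tendsto (fun t : ℝ => f t * t - 4 * primitiveF f t) atTop atTop)
    (c : ℝ) (hc : IsGLB (energy f lam '' nodalNehariSet f lam) c)
    (u : H1rad) (hu : u ∈ nodalNehariSet f lam) (huc : energy f lam u = c) :
    IsCriticalPoint (energy f lam) u ∧ IsCriticalValue (energy f lam) c := by
  obtain ⟨C, hC, hfb⟩ := exists_growth hf1 hf2 hf3 hf4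
  choose D hD hDv using exists_hasFDerivAt_energy lam hf1 hfb hC
  suffices h0 : D u = 0 by
    have hcrit : IsCriticalPoint (energy f lam) u := by
      have := hD u
      rwa [h0] at this
    exact ⟨hcrit, u, hcrit, huc⟩
  obtain ⟨⟨-, huu⟩, p, m, hp, hm, hup, hp0, hm0⟩ := hu
  obtain rfl := H1rad.eq_pos_of_isPosPart hp
  obtain rfl := H1rad.eq_of_isNegPart hm
  rw [(hD u).fderiv] at huu hup
  have hn0 : (-u).pos ≠ 0 := fun h => hm0 (by rw [h, neg_zero])
  have hsub := u.pos_sub_pos_neg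
  have hpair := u.isDisjointPair
  have hzp : energyDeriv f lam (u.pos - (-u).pos) u.pos = 0 := by rw [hsub, ← hDv, hup]
  have hun : D u (-u).pos = 0 := by
    have h1 : (-u).pos = u.pos - u := by
      nth_rewrite 3 [← hsub]
      abel
    rw [h1, (D u).map_sub, hup, huu, sub_zero]
  have hzn : energyDeriv f lam ((-u).pos - u.pos) (-u).pos = 0 := by
    rw [← neg_sub, hsub, energyDeriv_neg lam hf2, ← hDv, hun, neg_zero]
  have hswap : ∀ s t : ℝ, -(s • u.pos - t • (-u).pos) = t • (-u).pos - s • u.pos := fun s t =>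
    neg_sub _ _
  -- the derivatives in the directions of the positive and negative parts
  have d1 : ∀ s t : ℝ, 0 < s → 0 < t → D (s • u.pos - t • (-u).pos)
      (s • u.pos - t • (-u).pos).pos = s * energyDeriv f lam (s • u.pos - t • (-u).pos) u.pos := by
    intro s t hs ht
    rw [hpair.pos_family hs.le ht.le, (D _).map_smul, smul_eq_mul, hDv]
  have d2 : ∀ s t : ℝ, 0 < s → 0 < t → D (s • u.pos - t • (-u).pos)
      (-(s • u.pos - t • (-u).pos)).pos =
        -(t * energyDeriv f lam (t • (-u).pos - s • u.pos) (-u).pos) := by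
    intro s t hs ht
    rw [hswap, hpair.symm.pos_family ht.le hs.le, (D _).map_smul, smul_eq_mul, hDv, ← hswap s t,
      energyDeriv_neg lam hf2, mul_neg, neg_neg]
  have key : D (u.pos - (-u).pos) = 0 := by
    refine fderiv_eq_zero_of_nodal_minimizer (I := energy f lam) (P := H1rad.pos) hD ?_
      H1rad.continuous_pos (by rwa [hsub]) (by rwa [hsub]) ?_ ?_ ?_ ?_ ?_ ?_
    · simp only [hDv]
      exact continuous_energyDeriv lam hf1 hfb hC
    · intro s t hs hs1 hst
      rw [d1 s t hs (hs.trans_le hst)]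
      exact mul_pos hs (hpair.energyDeriv_pos hlam hf1 hfb hC hf5 hp0 hzp hs hs1 hst)
    · intro s t hs1 ht hts
      rw [d1 s t (one_pos.trans hs1) ht]
      exact mul_neg_of_pos_of_neg (one_pos.trans hs1)
        (hpair.energyDeriv_lt_zero hlam hf1 hfb hC hf5 hp0 hzp hs1 ht hts)
    · intro s t ht ht1 hts
      rw [d2 s t (ht.trans_le hts) ht, neg_lt_zero]
      exact mul_pos ht (hpair.symm.energyDeriv_pos hlam hf1 hfb hC hf5 hn0 hzn ht ht1 hts)
    · intro s t ht1 hs hst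
      rw [d2 s t hs (one_pos.trans ht1), neg_pos]
      exact mul_neg_of_pos_of_neg (one_pos.trans ht1)
        (hpair.symm.energyDeriv_lt_zero hlam hf1 hfb hC hf5 hn0 hzn ht1 hs hst)
    · intro s t hs ht
      exact hpair.energy_family_le hlam hf1 hf2 hfb hC hf5 hzp hzn hs ht
    · intro w hw1 hw2 hz1 hz2
      rw [hsub, huc]
      refine hc.1 ⟨w, ⟨⟨fun h => hw1 (by rw [h, H1rad.pos_zero]), ?_⟩, w.pos, -(-w).pos,
        w.isPosPart_pos, w.isNegPart_neg_pos_neg, ?_, hw1, neg_ne_zero.2 hw2⟩, rfl⟩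
      · rw [(hD w).fderiv]
        nth_rewrite 2 [← w.pos_sub_pos_neg]
        rw [(D w).map_sub, hz1, hz2, sub_zero]
      · rw [(hD w).fderiv, hz1]
  rwa [hsub] at key
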